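/- Conventions. For an algebraically closed field $K$, a \emph{CM-curve} in $\mathbb P^n_K$ is a finite morphism $i\colon X\to\mathbb P^n_K$ such that $X$ is Cohen--Macaulay of pure dimension one and $i$ is, outside a finite closed set of points, an isomorphism onto its schematic image. A point $P$ of the schematic image $D$ of a CM-curve $i\colon X\to\mathbb P^n_K$ is a \emph{plain double point} if the $\mathcal O_{D,P}$-module $(i_*\mathcal O_X/\mathcal O_D)_P$ has length one. A \emph{family of CM-curves} in $\mathbb P^n$ over a ring $R$ is a finite morphism $i_R\colon X_R\to\mathbb P^n_R$ such that $X_R$ is flat over $R$ and, for every algebraically closed field $K$ and every morphism $\operatorname{Spec}K\to\operatorname{Spec}R$, the base change $X_K\to\mathbb P^n_K$ is a CM-curve. Proposition. Let $R$ be a Noetherian local ring whose residue field $\kappa$ is algebraically closed, and let $i_R\colon X_R\to\mathbb P^2_R$ be a family of CM-curves over $R$. Let $i\colon X\to\mathbb P^2_\kappa$ be its closed fibre, let $P\in\mathbb P^2_\kappa$ be a plain double point of $i$, and let $\xi\in\mathbb P^2_R$ be the image of $P$ under the natural inclusion $\mathbb P^2_\kappa\subseteq\mathbb P^2_R$. Then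 $\xi$ lies on the schematic image $D_R\subseteq\mathbb P^2_R$ of $X_R$, and there are elements $g,f,s,t\in\mathcal O_{\mathbb P^2_R,\xi}$ and an exact sequence of $\mathcal O_{\mathbb P^2_R,\xi}$-modules $$\mathcal O_{\mathbb P^2_R,\xi}^{\oplus 2}\xrightarrow{\begin{pmatrix} g&f\\ s&t\end{pmatrix}}\mathcal O_{\mathbb P^2_R,\xi}^{\oplus 2}\longrightarrow (i_{R*}\mathcal O_{X_R})_\xi\longrightarrow 0$$ such that $s$ and $t$ lie in the maximal ideal of $\mathcal O_{\mathbb P^2_R,\xi}$, and $g$ and $f$ lie in the ideal $\mathfrak n_R=(s,t)$. Furthermore, $\mathfrak n_R$ contains the ideal of $D_R$ in $\mathcal O_{\mathbb P^2_R,\xi}$, and its image in $\mathcal O_{D_R,\xi}$ is the annihilator (conductor) ideal $\operatorname{Ann}_{\mathcal O_{D_R,\xi}}\big((i_{R*}\mathcal O_{X_R}/\mathcal O_{D_R})_\xi\big)$. -/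

import Mathlib

open AlgebraicGeometry CategoryTheory CategoryTheory.Limits
open scoped TopCat

universe u

noncomputable section

namespace CMCurve

attribute [local instance] MvPolynomial.gradedAlgebra

/-- Projective `n`-space `ℙⁿ_R = Proj R[x₀, …, xₙ]`. -/
abbrev ProjSpace (n : ℕ) (R : Type u) [CommRing R] : Scheme.{u} :=
  Proj (MvPolynomial.homogeneousSubmodule (Fin (n + 1)) R)

/-- The structure morphism `ℙⁿ_R ⟶ Spec R`. -/
def ProjSpace.toSpec (n : ℕ) (R : Type u) [CommRing R] :
    ProjSpace n R ⟶ Spec (CommRingCat.of R) :=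
  Proj.toSpecZero (MvPolynomial.homogeneousSubmodule (Fin (n + 1)) R) ≫
    Spec.map (CommRingCat.ofHom
      (algebraMap R (MvPolynomial.homogeneousSubmodule (Fin (n + 1)) R 0)))

/-- A Cohen-Macaulay local ring: a Noetherian local ring `A` whose maximal ideal contains an
`A`-regular sequence of length `dim A` (that is, `depth A = dim A`). -/
def IsCohenMacaulayLocalRing (A : Type u) [CommRing A] [IsLocalRing A] : Prop :=
  IsNoetherianRing A ∧ ∃ rs : List A,
    (∀ r ∈ rs, r ∈ IsLocalRing.maximalIdeal A) ∧ RingTheory.Sequence.IsRegular A rs ∧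
      (rs.length : WithBot ℕ∞) = ringKrullDim A

/-- A Cohen-Macaulay scheme: locally Noetherian with Cohen-Macaulay local rings. -/
def IsCohenMacaulayScheme (X : Scheme.{u}) : Prop :=
  IsLocallyNoetherian X ∧ ∀ x : X, IsCohenMacaulayLocalRing (X.presheaf.stalk x)

/-- Every irreducible component has dimension one. -/
def IsPureDimOne (X : Scheme.{u}) : Prop :=
  ∀ Z ∈ irreducibleComponents X, topologicalKrullDim Z = 1

/-- The morphism `i : X ⟶ Y` is a CM-curve in `Y` (below `Y` is a projective space over an
algebraically closed field): `i` is finite, `X` is Cohen-Macaulay of pure dimension one, and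
`i` is an isomorphism onto its schematic image outside a finite closed set of points of the
image. -/
structure IsCMCurve {X Y : Scheme.{u}} (i : X ⟶ Y) : Prop where
  finite : IsFinite i
  cohenMacaulay : IsCohenMacaulayScheme X
  pureDimOne : IsPureDimOne X
  isoOffFinite : ∃ U : i.image.Opens, ((U : Set i.image)ᶜ).Finite ∧ IsIso (i.toImage ∣_ U)

/-- For `x : Spec K ⟶ Spec R`, the base change `ℙⁿ_K = ℙⁿ_R ×_R K`. -/
abbrev fibreSpace (n : ℕ) {R K : Type u} [CommRing R] [CommRing K]
    (x : Spec (CommRingCat.of K) ⟶ Spec (CommRingCat.of R)) : Scheme.{u} :=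
  pullback (ProjSpace.toSpec n R) x

/-- The natural morphism `ℙⁿ_K ⟶ ℙⁿ_R`. -/
abbrev fibreSpaceMap (n : ℕ) {R K : Type u} [CommRing R] [CommRing K]
    (x : Spec (CommRingCat.of K) ⟶ Spec (CommRingCat.of R)) : fibreSpace n x ⟶ ProjSpace n R :=
  pullback.fst (ProjSpace.toSpec n R) x

/-- The fibre `i_K : X_K ⟶ ℙⁿ_K` of `i : X ⟶ ℙⁿ_R` along `x : Spec K ⟶ Spec R`, with
`X_K = X ×_R K` written as `X ×_{ℙⁿ_R} ℙⁿ_K`. -/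
abbrev fibreMap {n : ℕ} {R K : Type u} [CommRing R] [CommRing K] {X : Scheme.{u}}
    (i : X ⟶ ProjSpace n R) (x : Spec (CommRingCat.of K) ⟶ Spec (CommRingCat.of R)) :
    pullback i (fibreSpaceMap n x) ⟶ fibreSpace n x :=
  pullback.snd i (fibreSpaceMap n x)

/-- A family of CM-curves in `ℙⁿ` over `Spec R`: a finite morphism `i : X ⟶ ℙⁿ_R` with `X` flat
over `R` whose fibres over all geometric points of `Spec R` are CM-curves. -/
structure IsCMFamily {n : ℕ} {R : Type u} [CommRing R] {X : Scheme.{u}}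
    (i : X ⟶ ProjSpace n R) : Prop where
  finite : IsFinite i
  flat : Flat (i ≫ ProjSpace.toSpec n R)
  geometricFibre : ∀ (K : Type u) [Field K] [IsAlgClosed K]
    (x : Spec (CommRingCat.of K) ⟶ Spec (CommRingCat.of R)), IsCMCurve (fibreMap i x)

/-- The closed point `Spec κ ⟶ Spec R` of a local ring `R` with residue field `κ`. -/
abbrev closedPt (R : Type u) [CommRing R] [IsLocalRing R] :
    Spec (CommRingCat.of (IsLocalRing.ResidueField R)) ⟶ Spec (CommRingCat.of R) :=
  Spec.map (CommRingCat.ofHom (IsLocalRing.residue R))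

/-- The stalk `(i_* 𝒪_X)_y`. -/
def PushforwardStalk {X Y : Scheme.{u}} (i : X ⟶ Y) (y : Y) : Type u :=
  ((i.base _* X.presheaf).stalk y : CommRingCat.{u})

instance {X Y : Scheme.{u}} (i : X ⟶ Y) (y : Y) : CommRing (PushforwardStalk i y) :=
  inferInstanceAs (CommRing ((i.base _* X.presheaf).stalk y : CommRingCat.{u}))

/-- The `𝒪_{Y,y}`-algebra structure on `(i_* 𝒪_X)_y`, induced by `𝒪_Y ⟶ i_* 𝒪_X`. -/
instance {X Y : Scheme.{u}} (i : X ⟶ Y) (y : Y) :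
    Algebra (Y.presheaf.stalk y) (PushforwardStalk i y) :=
  ((TopCat.Presheaf.stalkFunctor CommRingCat.{u} y).map i.c).hom.toAlgebra

/-- The stalk at `η ∈ D` of the sheaf `𝒦 = i_* 𝒪_X / 𝒪_D`, where `D` is the schematic image of
`i : X ⟶ Y`, as a module over `𝒪_{D,η}`. -/
abbrev CokernelStalk {X Y : Scheme.{u}} (i : X ⟶ Y) (η : i.image) : Type u :=
  PushforwardStalk i.toImage η ⧸
    LinearMap.range (Algebra.linearMap (i.image.presheaf.stalk η) (PushforwardStalk i.toImage η))

/-- `P` is a point of the schematic image `D` of `i` and `𝒦_P` has length one over `𝒪_{D,P}`. -/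
def IsPlainDoublePoint {X Y : Scheme.{u}} (i : X ⟶ Y) (P : Y) : Prop :=
  ∃ η : i.image, i.imageι η = P ∧
    Module.length (i.image.presheaf.stalk η) (CokernelStalk i η) = 1

end CMCurve

end

/-! Write `A`, `B` for the stalks at `ξ` of the structure sheaf of the plane and of the direct image
of `𝒪_X`, and `A₀`, `B₀` for the same stalks on the closed fibre. Length one of `B₀ / 𝒪_D` means
that this module is simple, so `B₀` is generated over `A₀` by `1` and any `v₀` outside the image of
`A₀`.

The relations between `1` and `v₀` need only two generators. At a closed point of the plane the
maximal ideal of `A₀` has two generators, and no nonzero element of `B₀` is killed by it, because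
the fibre is Cohen-Macaulay of pure dimension one. If `A₀` is not a field, prime avoidance gives a
parameter `z` outside `𝔪²` that is injective on `B₀`. Then `A₀ / z` is a principal ideal ring, over
which submodules of a free module of rank two have two generators, and Nakayama lifts these to `A₀`
(`exists_ker_eq_span_pair`). When the maximal ideal is principal, `A₀` itself is a principal ideal
ring.

Nakayama also lifts the generators `1, v` to `B` over `A`. Flatness of `B` over `R` makes the
relation module compatible with reduction, so its two generators lift as well
(`exists_presentation`). The columns of the matrix are these two relations `g + s v = 0` and `f + t
v = 0`.

The conductor statements are then formal. An element `a` carries `B` into the image of `A` exactly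
when `a v` lies in that image, that is, when `a` is the second coordinate of a relation. So `(s, t)`
is the conductor. It is proper because `v` does not come from `A`, and it contains `g = -s v` and `f
= -t v` because the conductor is stable under multiplication by `B`. The rest identifies these
stalks with localizations of sections over a standard affine chart. -/

noncomputable section

namespace CMCurve

/-! ### Commutative algebra: two-generated relation modules, flat lifting and conductors. -/

section Algebra

open IsLocalRing

/-- A Noetherian local ring with principal maximal ideal is a principal ideal ring. -/
lemma isPrincipalIdealRing_of_maximalIdeal {A : Type*} [CommRing A] [IsLocalRing A]
    [IsNoetherianRing A] (w : A) (hw : maximalIdeal A = Ideal.span {w}) :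
    IsPrincipalIdealRing A := by
  refine IsPrincipalIdealRing.of_prime fun P hP ↦ ?_
  by_cases hwP : w ∈ P
  · have : P = Ideal.span {w} := le_antisymm (hw ▸ le_maximalIdeal hP.ne_top)
      ((Ideal.span_singleton_le_iff_mem _).2 hwP)
    exact ⟨w, this⟩
  -- Here every element of `P` is `c * w` with `c ∈ P` by primality, so `P = 𝔪 P` and Nakayama gives
  -- `P = 0`.
  · have : P = ⊥ := by
      refine Submodule.eq_bot_of_le_smul_of_le_jacobson_bot (maximalIdeal A) P
        (IsNoetherian.noetherian P) (fun p hp ↦ ?_) (maximalIdeal_le_jacobson _)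
      have hpm : p ∈ Ideal.span {w} := hw ▸ le_maximalIdeal hP.ne_top hp
      obtain ⟨c, rfl⟩ := Ideal.mem_span_singleton'.1 hpm
      rw [mul_comm]
      refine Submodule.smul_mem_smul (hw ▸ Ideal.mem_span_singleton_self w) ?_
      exact (hP.mem_or_mem hp).resolve_right hwP
    exact this ▸ bot_isPrincipal

/-- Over a principal ideal ring, submodules of a free module of rank two need two generators. -/
lemma exists_span_pair_of_isPrincipalIdealRing {A : Type*} [CommRing A] [IsPrincipalIdealRing A]
    (N : Submodule A (Fin 2 → A)) : ∃ n₁ n₂, N = Submodule.span A {n₁, n₂} := by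
  -- Echelon form: `c` generates the first coordinates of `N`, and `d` the second coordinates of
  -- those elements whose first coordinate vanishes.
  obtain ⟨c, hc⟩ := IsPrincipalIdealRing.principal (N.map (LinearMap.proj 0))
  obtain ⟨d, hd⟩ := IsPrincipalIdealRing.principal
    ((N ⊓ LinearMap.ker (LinearMap.proj 0 : (Fin 2 → A) →ₗ[A] A)).map (LinearMap.proj 1))
  obtain ⟨n₁, hn₁, h₁⟩ : c ∈ N.map (LinearMap.proj 0) := hc ▸ Submodule.mem_span_singleton_self c
  obtain ⟨n₂, ⟨hn₂, h₂0⟩, h₂⟩ := (hd ▸ Submodule.mem_span_singleton_self d :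
    d ∈ (N ⊓ LinearMap.ker (LinearMap.proj 0 : (Fin 2 → A) →ₗ[A] A)).map (LinearMap.proj 1))
  refine ⟨n₁, n₂, le_antisymm (fun n hn ↦ ?_) ?_⟩
  · have h0 : n 0 ∈ N.map (LinearMap.proj 0) := ⟨n, hn, rfl⟩
    rw [hc] at h0
    obtain ⟨a, ha⟩ := Submodule.mem_span_singleton.1 h0
    have h1 : (n - a • n₁) 1 ∈
        (N ⊓ LinearMap.ker (LinearMap.proj 0 : (Fin 2 → A) →ₗ[A] A)).map (LinearMap.proj 1) := by
      refine ⟨n - a • n₁, ⟨N.sub_mem hn (N.smul_mem a hn₁), ?_⟩, rfl⟩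
      simp only [LinearMap.proj_apply] at h₁
      simp [h₁, ← ha]
    rw [hd] at h1
    obtain ⟨b, hb⟩ := Submodule.mem_span_singleton.1 h1
    refine Submodule.mem_span_pair.2 ⟨a, b, ?_⟩
    simp only [LinearMap.proj_apply, SetLike.mem_coe, LinearMap.mem_ker] at h₁ h₂ h₂0
    ext k
    fin_cases k
    · simp [h₁, h₂0, ← ha]
    · simp only [smul_eq_mul, Pi.sub_apply, Pi.smul_apply] at hb
      simp [h₂, hb]
  · rw [Submodule.span_le]
    rintro x (rfl | rfl)
    exacts [hn₁, hn₂]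

/-- Nakayama's lemma for two generators of a submodule of `A²`, along a surjection `A → A'`. -/
lemma exists_span_pair_of_surjective {A A' : Type*} [CommRing A] [IsLocalRing A]
    [IsNoetherianRing A] [CommRing A'] (φ : A →+* A') (hφ : Function.Surjective φ)
    (hm : RingHom.ker φ ≤ maximalIdeal A)
    (N : Submodule A (Fin 2 → A)) (N' : Submodule A' (Fin 2 → A'))
    (hNN' : ∀ n ∈ N, φ ∘ n ∈ N') (hN'N : ∀ n' ∈ N', ∃ n ∈ N, φ ∘ n = n')
    (hker : ∀ n ∈ N, φ ∘ n = 0 → n ∈ RingHom.ker φ • N)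
    (hN' : ∃ n₁ n₂, N' = Submodule.span A' {n₁, n₂}) :
    ∃ n₁ n₂, N = Submodule.span A {n₁, n₂} := by
  obtain ⟨p₁, p₂, hp⟩ := hN'
  obtain ⟨n₁, hn₁, h₁⟩ := hN'N p₁ (hp ▸ Submodule.subset_span (by simp))
  obtain ⟨n₂, hn₂, h₂⟩ := hN'N p₂ (hp ▸ Submodule.subset_span (by simp))
  have hle : Submodule.span A {n₁, n₂} ≤ N := by
    rw [Submodule.span_le]
    rintro x (rfl | rfl)
    exacts [hn₁, hn₂]
  refine ⟨n₁, n₂, le_antisymm ?_ hle⟩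
  refine Submodule.le_of_le_smul_of_le_jacobson_bot (I := RingHom.ker φ)
    (IsNoetherian.noetherian N) (hm.trans (maximalIdeal_le_jacobson _)) fun n hn ↦ ?_
  have h := hNN' n hn
  rw [hp] at h
  obtain ⟨a', b', hab⟩ := Submodule.mem_span_pair.1 h
  obtain ⟨a, rfl⟩ := hφ a'
  obtain ⟨b, rfl⟩ := hφ b'
  have hs : a • n₁ + b • n₂ ∈ Submodule.span A {n₁, n₂} := Submodule.mem_span_pair.2 ⟨a, b, rfl⟩
  rw [← add_sub_cancel (a • n₁ + b • n₂) n]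
  refine Submodule.add_mem_sup hs (hker _ (N.sub_mem hn (hle hs)) ?_)
  ext k
  have := congr_fun hab k
  simp only [← h₁, ← h₂, Pi.add_apply, Pi.smul_apply, Function.comp_apply, smul_eq_mul] at this
  simp [this]

/-- Writing `n = z • c`, injectivity of `z` on `M` forces `c` itself to be a relation. This is the
kernel condition of `exists_span_pair_of_surjective` for reduction modulo `z`. -/
lemma mem_ker_smul_of_comp_eq_zero {A M : Type*} [CommRing A] [AddCommGroup M] [Module A M]
    (π : (Fin 2 → A) →ₗ[A] M) (z : A) (hz : ∀ b : M, z • b = 0 → b = 0) (n : Fin 2 → A)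
    (hn : n ∈ LinearMap.ker π) (h0 : Ideal.Quotient.mk (Ideal.span {z}) ∘ n = 0) :
    n ∈ RingHom.ker (Ideal.Quotient.mk (Ideal.span {z})) • LinearMap.ker π := by
  have h (k) : ∃ c, c * z = n k := by
    have := congr_fun h0 k
    simp only [Function.comp_apply, Pi.zero_apply] at this
    exact Ideal.mem_span_singleton'.1 (Ideal.Quotient.eq_zero_iff_mem.1 this)
  choose c hc using h
  have hnc : n = z • c := by ext k; simp [← hc, mul_comm]
  rw [Ideal.mk_ker, hnc]
  refine Submodule.smul_mem_smul (Ideal.mem_span_singleton_self z) ?_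
  rw [hnc, LinearMap.mem_ker, map_smul] at hn
  exact hz _ hn

/-- If `𝔪` has two generators and no nonzero element of `M` is killed by `𝔪`, then the relation
module of any two generators of `M` is generated by two elements. -/
lemma exists_ker_eq_span_pair {A M : Type*} [CommRing A] [IsLocalRing A] [IsNoetherianRing A]
    [AddCommGroup M] [Module A M] [Module.Finite A M] (x y : A)
    (hm : maximalIdeal A = Ideal.span {x, y})
    (hM : ∀ b : M, (∀ a ∈ maximalIdeal A, a • b = 0) → b = 0) (π : (Fin 2 → A) →ₗ[A] M) :
    ∃ n₁ n₂, LinearMap.ker π = Submodule.span A {n₁, n₂} := by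
  -- If `𝔪 = 𝔪²`, then `𝔪 = 0` by Nakayama and `A` is a field; the avoidance argument below needs `𝔪
  -- ≠ 𝔪²`.
  by_cases hm2 : maximalIdeal A ≤ maximalIdeal A ^ 2
  · have : maximalIdeal A = ⊥ := by
      refine Submodule.eq_bot_of_le_smul_of_le_jacobson_bot (maximalIdeal A) _
        (IsNoetherian.noetherian _) ?_ (maximalIdeal_le_jacobson _)
      rwa [smul_eq_mul, ← pow_two]
    have := isPrincipalIdealRing_of_maximalIdeal (0 : A) (by simpa using this)
    exact exists_span_pair_of_isPrincipalIdealRing _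
  -- Prime avoidance against the finitely many associated primes of `M` together with `𝔪²`, the one
  -- member allowed not to be prime. An associated prime containing `𝔪` would annihilate a nonzero
  -- element of `M`, against `hM`.
  obtain ⟨z, hzm, hz2, hz⟩ : ∃ z ∈ maximalIdeal A, z ∉ maximalIdeal A ^ 2 ∧
      ∀ b : M, z • b = 0 → b = 0 := by
    by_contra! hcon
    have hsub : (maximalIdeal A : Set A) ⊆
        ⋃ p ∈ insert (maximalIdeal A ^ 2) (associatedPrimes A M), (p : Set A) := by
      intro z hz
      rw [Set.biUnion_insert, biUnion_associatedPrimes_eq_zero_divisors]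
      by_cases hz2 : z ∈ maximalIdeal A ^ 2
      · exact Or.inl hz2
      · obtain ⟨b, hb, hb0⟩ := hcon z hz hz2
        exact Or.inr ⟨b, hb0, hb⟩
    obtain ⟨p, hp, hle⟩ := (Ideal.subset_union_prime_finite
      ((associatedPrimes.finite A M).insert _) (f := id) (maximalIdeal A ^ 2)
      (maximalIdeal A ^ 2) (fun p hp hne _ ↦
        (hp.resolve_left hne).isPrime)).1 hsub
    rcases hp with rfl | hp
    · exact hm2 hle
    · obtain ⟨hpp, b, hb⟩ := (isAssociatedPrime_iff).1 hp
      have hpb : ∀ a ∈ maximalIdeal A, a • b = 0 := fun a ha ↦ by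
        have := hle ha
        simp only [id] at this
        rw [hb] at this
        simpa using this
      have := hM b hpb
      refine hpp.ne_top ?_
      rw [hb, this]
      ext; simp
  -- As `z = α x + β y` lies outside `𝔪²`, one of `α`, `β` is a unit, so `z` can replace `x` or `y`
  -- as a generator.
  have hzw : ∃ w, maximalIdeal A = Ideal.span {z, w} := by
    have hz' := hzm
    rw [hm] at hz'
    obtain ⟨α, β, hαβ⟩ := Ideal.mem_span_pair.1 hz'
    have hx : x ∈ maximalIdeal A := hm ▸ Ideal.subset_span (by simp)
    have hy : y ∈ maximalIdeal A := hm ▸ Ideal.subset_span (by simp)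
    have key : IsUnit α ∨ IsUnit β := by
      by_contra! hu
      refine hz2 ?_
      rw [← hαβ, pow_two]
      exact Ideal.add_mem _ (Ideal.mul_mem_mul hu.1 hx) (Ideal.mul_mem_mul hu.2 hy)
    rcases key with ⟨u, rfl⟩ | ⟨u, rfl⟩
    · refine ⟨y, le_antisymm ?_ ?_⟩
      · rw [hm]
        refine Ideal.span_le.2 (Set.pair_subset ?_ (Ideal.subset_span (by simp)))
        refine Ideal.mem_span_pair.2 ⟨((u⁻¹ : Aˣ) : A), -((u⁻¹ : Aˣ) : A) * β, ?_⟩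
        rw [← hαβ]
        linear_combination x * u.inv_mul
      · exact Ideal.span_le.2 (Set.pair_subset hzm hy)
    · refine ⟨x, le_antisymm ?_ (Ideal.span_le.2 (Set.pair_subset hzm hx))⟩
      rw [hm]
      refine Ideal.span_le.2 (Set.pair_subset (Ideal.subset_span (by simp)) ?_)
      refine Ideal.mem_span_pair.2 ⟨((u⁻¹ : Aˣ) : A), -((u⁻¹ : Aˣ) : A) * α, ?_⟩
      rw [← hαβ]
      linear_combination y * u.inv_mul
  obtain ⟨w, hw⟩ := hzw
  let φ := Ideal.Quotient.mk (Ideal.span {z})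
  have hφ : Function.Surjective φ := Ideal.Quotient.mk_surjective
  have hkerm : RingHom.ker φ ≤ maximalIdeal A := by
    rw [Ideal.mk_ker]; exact (Ideal.span_singleton_le_iff_mem _).2 hzm
  have : Nontrivial (A ⧸ Ideal.span {z}) := by
    rw [Ideal.Quotient.nontrivial_iff]
    intro h
    rw [Ideal.mk_ker, h, top_le_iff] at hkerm
    exact (maximalIdeal.isMaximal A).ne_top hkerm
  have : IsLocalRing (A ⧸ Ideal.span {z}) := .of_surjective' φ hφ
  have hmax : maximalIdeal (A ⧸ Ideal.span {z}) = Ideal.span {φ w} := by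
    have h1 := IsLocalRing.map_maximalIdeal_of_surjective φ hφ
    rw [← h1, hw, Ideal.map_span, Set.image_pair]
    have : φ z = 0 := Ideal.Quotient.eq_zero_iff_mem.2 (Ideal.mem_span_singleton_self z)
    rw [this, Ideal.span_insert_zero]
  have := isPrincipalIdealRing_of_maximalIdeal (φ w) hmax
  -- The image of the relation module in `(A/z)²`; it is closed under scalars because those lift to
  -- `A`.
  let N' : Submodule (A ⧸ Ideal.span {z}) (Fin 2 → A ⧸ Ideal.span {z}) :=
    { carrier := {p | ∃ n ∈ LinearMap.ker π, φ ∘ n = p}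
      add_mem' := by
        rintro _ _ ⟨n, hn, rfl⟩ ⟨m, hm, rfl⟩
        exact ⟨n + m, add_mem hn hm, by ext; simp⟩
      zero_mem' := ⟨0, zero_mem _, by ext; simp⟩
      smul_mem' := by
        rintro c _ ⟨n, hn, rfl⟩
        obtain ⟨c, rfl⟩ := hφ c
        exact ⟨c • n, Submodule.smul_mem _ _ hn, by ext; simp⟩ }
  exact exists_span_pair_of_surjective φ hφ hkerm (LinearMap.ker π) N' (fun n hn ↦ ⟨n, hn, rfl⟩)
    (fun _ h ↦ h) (mem_ker_smul_of_comp_eq_zero π z hz) (exists_span_pair_of_isPrincipalIdealRing N')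

lemma exists_sum_smul_of_mem_map {R A : Type*} [CommRing R] [CommRing A] [Algebra R A]
    (I : Ideal R) (x : A) (hx : x ∈ I.map (algebraMap R A)) :
    ∃ (k : ℕ) (r : Fin k → R) (a : Fin k → A), (∀ j, r j ∈ I) ∧ x = ∑ j, r j • a j := by
  rw [Ideal.map] at hx
  obtain ⟨k, a, g, h⟩ := Submodule.mem_span_set'.1 hx
  choose r hr hrg using fun j ↦ (g j).2
  refine ⟨k, r, a, hr, ?_⟩
  rw [← h]
  refine Finset.sum_congr rfl fun j _ ↦ ?_
  rw [Algebra.smul_def (r j), hrg, smul_eq_mul, mul_comm]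

/-- The relations of a flat module whose coefficients lie in `IA` are `I`-linear combinations of
relations. -/
lemma mem_smul_ker_of_flat {R A M : Type*} [CommRing R] [CommRing A] [Algebra R A]
    [AddCommGroup M] [Module A M] [Module R M] [IsScalarTower R A M] [Module.Flat R M]
    (I : Ideal R) (π : (Fin 2 → A) →ₗ[A] M) (hπ : Function.Surjective π) (n : Fin 2 → A)
    (hn : n ∈ LinearMap.ker π) (h : ∀ k, n k ∈ I.map (algebraMap R A)) :
    n ∈ I.map (algebraMap R A) • LinearMap.ker π := by
  obtain ⟨k₀, r₀, a₀, hr₀, h₀⟩ := exists_sum_smul_of_mem_map I _ (h 0)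
  obtain ⟨k₁, r₁, a₁, hr₁, h₁⟩ := exists_sum_smul_of_mem_map I _ (h 1)
  let r : Fin k₀ ⊕ Fin k₁ → R := Sum.elim r₀ r₁
  let a : Fin k₀ ⊕ Fin k₁ → (Fin 2 → A) := Sum.elim (fun j ↦ ![a₀ j, 0]) (fun j ↦ ![0, a₁ j])
  have hr (j) : r j ∈ I := by rcases j with j | j; exacts [hr₀ j, hr₁ j]
  have hna : n = ∑ j, r j • a j := by
    ext k
    fin_cases k
    · simp [r, a, h₀]
    · simp [r, a, h₁]
  have hrel : ∑ j, r j • π (a j) = 0 := by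
    rw [LinearMap.mem_ker, hna, map_sum] at hn
    rw [← hn]
    refine Finset.sum_congr rfl fun j _ ↦ ?_
    rw [← algebraMap_smul A (r j) (a j), map_smul, algebraMap_smul]
  -- Equational criterion for flatness: `π (a j) = ∑ c j l • y l` with `∑ r j * c j l = 0`.
  -- Subtracting lifts of these sums turns each `a j` into a relation without changing `∑ r j • a
  -- j`.
  obtain ⟨k, c, y, hxy, hc⟩ := Module.Flat.isTrivialRelation_of_sum_smul_eq_zero hrel
  beta_reduce at hxy
  choose y' hy' using fun j ↦ hπ (y j)
  have hmem (j) : a j - ∑ l, c j l • y' l ∈ LinearMap.ker π := by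
    rw [LinearMap.mem_ker, map_sub, hxy, map_sum, sub_eq_zero]
    refine Finset.sum_congr rfl fun l _ ↦ ?_
    rw [← algebraMap_smul A (c j l) (y' l), map_smul, algebraMap_smul, hy']
  have hzero : ∑ j, r j • ∑ l, c j l • y' l = 0 := by
    simp_rw [Finset.smul_sum, smul_smul]
    rw [Finset.sum_comm]
    refine Finset.sum_eq_zero fun l _ ↦ ?_
    rw [← Finset.sum_smul, hc, zero_smul]
  have : n = ∑ j, algebraMap R A (r j) • (a j - ∑ l, c j l • y' l) := by
    simp_rw [algebraMap_smul, smul_sub, Finset.sum_sub_distrib]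
    rw [hzero, sub_zero, hna]
  rw [this]
  exact Submodule.sum_mem _ fun j _ ↦
    Submodule.smul_mem_smul (Ideal.mem_map_of_mem _ (hr j)) (hmem j)

/-- The linear map `A² → B`, `(a, b) ↦ a + b v`. -/
def pairMap (A : Type*) {B : Type*} [CommRing A] [CommRing B] [Algebra A B] (v : B) :
    (Fin 2 → A) →ₗ[A] B :=
  (LinearMap.proj 0).smulRight 1 + (LinearMap.proj 1).smulRight v

lemma pairMap_apply {A B : Type*} [CommRing A] [CommRing B] [Algebra A B] (v : B)
    (n : Fin 2 → A) : pairMap A v n = algebraMap A B (n 0) + algebraMap A B (n 1) * v := by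
  simp [pairMap, Algebra.smul_def]

lemma mem_ker_pairMap {A B : Type*} [CommRing A] [CommRing B] [Algebra A B] (v : B)
    (n : Fin 2 → A) : n ∈ LinearMap.ker (pairMap A v) ↔
      algebraMap A B (n 0) + algebraMap A B (n 1) * v = 0 := by
  rw [LinearMap.mem_ker, pairMap_apply]

/-- Presentations of `B` by `1, v` and two relations compute the conductor of `A → B`. -/
lemma span_pair_eq_conductor {A B : Type*} [CommRing A] [CommRing B] [Algebra A B] (v : B)
    (hv : Function.Surjective (pairMap A v)) (n₁ n₂ : Fin 2 → A)
    (hN : LinearMap.ker (pairMap A v) = Submodule.span A {n₁, n₂}) (a : A) :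
    a ∈ Ideal.span {n₁ 1, n₂ 1} ↔ ∀ b : B, ∃ c : A, algebraMap A B a * b = algebraMap A B c := by
  constructor
  · intro ha b
    obtain ⟨α, β, hαβ⟩ := Ideal.mem_span_pair.1 ha
    have hmem : α • n₁ + β • n₂ ∈ LinearMap.ker (pairMap A v) := by
      rw [hN]; exact Submodule.mem_span_pair.2 ⟨α, β, rfl⟩
    rw [mem_ker_pairMap] at hmem
    simp only [Pi.add_apply, Pi.smul_apply, smul_eq_mul] at hmem
    rw [hαβ] at hmem
    obtain ⟨m, rfl⟩ := hv b
    rw [pairMap_apply]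
    -- The relation `hmem` expresses `a v` as `-(α * n₁ 0 + β * n₂ 0)`; substitute this into `a (m 0
    -- + m 1 v)`.
    refine ⟨a * m 0 - m 1 * (α * n₁ 0 + β * n₂ 0), ?_⟩
    rw [map_sub, map_mul, map_mul]
    linear_combination (algebraMap A B (m 1)) * hmem
  · intro h
    obtain ⟨c, hc⟩ := h v
    have hmem : ![-c, a] ∈ LinearMap.ker (pairMap A v) := by
      rw [mem_ker_pairMap]; simp [hc]
    rw [hN] at hmem
    obtain ⟨α, β, hαβ⟩ := Submodule.mem_span_pair.1 hmem
    refine Ideal.mem_span_pair.2 ⟨α, β, ?_⟩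
    simpa using congr_fun hαβ 1

/-- From `n 0 + n 1 v = 0` one gets `n 0 * b = -n 1 * (v b)`, which comes from `A` because `n 1` is
in the conductor. Hence `n 0` is in the conductor too. -/
lemma apply_zero_mem_span_pair {A B : Type*} [CommRing A] [CommRing B] [Algebra A B] (v : B)
    (hv : Function.Surjective (pairMap A v)) (n₁ n₂ : Fin 2 → A)
    (hN : LinearMap.ker (pairMap A v) = Submodule.span A {n₁, n₂}) (n : Fin 2 → A)
    (hn : n ∈ LinearMap.ker (pairMap A v)) : n 0 ∈ Ideal.span {n₁ 1, n₂ 1} := by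
  rw [span_pair_eq_conductor v hv n₁ n₂ hN]
  intro b
  have h1 : n 1 ∈ Ideal.span {n₁ 1, n₂ 1} := by
    rw [hN] at hn
    obtain ⟨α, β, rfl⟩ := Submodule.mem_span_pair.1 hn
    exact Ideal.mem_span_pair.2 ⟨α, β, rfl⟩
  obtain ⟨c, hc⟩ := (span_pair_eq_conductor v hv n₁ n₂ hN _).1 h1 (v * b)
  rw [mem_ker_pairMap] at hn
  refine ⟨-c, ?_⟩
  rw [map_neg, ← hc]
  linear_combination b * hn

/-- The local algebra of a family of plain double points: if `B` is a finite `A`-algebra, flat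
over `R`, whose reduction `B₀` modulo `I` is generated by `1, v₀` with two relations over `A₀`,
then `B` is presented by a two by two matrix over `A` whose second row generates the conductor. -/
theorem exists_presentation {R A B A₀ B₀ : Type*} [CommRing R] [CommRing A] [CommRing B]
    [CommRing A₀] [CommRing B₀] [Algebra R A] [Algebra A B] [Algebra R B] [IsScalarTower R A B]
    [Algebra A₀ B₀] [IsLocalRing A] [IsNoetherianRing A] [Module.Finite A B] [Module.Flat R B]
    (I : Ideal R) (φ : A →+* A₀) (hφ : Function.Surjective φ)
    (hφk : RingHom.ker φ = I.map (algebraMap R A)) [Nontrivial A₀]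
    (ψ : B →+* B₀) (hψ : Function.Surjective ψ) (hψk : RingHom.ker ψ = I.map (algebraMap R B))
    (hφψ : ∀ a, ψ (algebraMap A B a) = algebraMap A₀ B₀ (φ a))
    (v₀ : B₀) (hv₀ : Function.Surjective (pairMap A₀ v₀))
    (hv₀' : ∀ a₀, algebraMap A₀ B₀ a₀ ≠ v₀)
    (hN₀ : ∃ n₁ n₂, LinearMap.ker (pairMap A₀ v₀) = Submodule.span A₀ {n₁, n₂}) :
    ∃ g f s t : A,
      (∃ π : (Fin 2 → A) →ₗ[A] B, Function.Surjective π ∧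
        LinearMap.ker π = LinearMap.range (!![g, f; s, t]).mulVecLin) ∧
      s ∈ maximalIdeal A ∧ t ∈ maximalIdeal A ∧
      g ∈ Ideal.span {s, t} ∧ f ∈ Ideal.span {s, t} ∧
      ∀ a, a ∈ Ideal.span {s, t} ↔
        ∀ b : B, ∃ c : A, algebraMap A B a * b = algebraMap A B c := by
  have hkm : RingHom.ker φ ≤ maximalIdeal A := le_maximalIdeal (RingHom.ker_ne_top φ)
  obtain ⟨v, rfl⟩ := hψ v₀
  have hcomp (n : Fin 2 → A) : ψ (pairMap A v n) = pairMap A₀ (ψ v) (φ ∘ n) := by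
    simp [pairMap_apply, hφψ]
  have hmapB : I.map (algebraMap R B) = (I.map (algebraMap R A)).map (algebraMap A B) := by
    rw [Ideal.map_map, ← IsScalarTower.algebraMap_eq]
  have hlift (n₀ : Fin 2 → A₀) : ∃ n : Fin 2 → A, φ ∘ n = n₀ := by
    choose n hn using fun k ↦ hφ (n₀ k)
    exact ⟨n, funext hn⟩
  have hsmul (b : B) (hb : ψ b = 0) : b ∈ RingHom.ker φ • (⊤ : Submodule A B) := by
    have : b ∈ (RingHom.ker φ).map (algebraMap A B) := by
      rw [hφk, ← hmapB, ← hψk]; exact hb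
    rwa [Ideal.smul_top_eq_map]
  have hv : Function.Surjective (pairMap A v) := by
    rw [← LinearMap.range_eq_top, ← top_le_iff]
    refine Submodule.le_of_le_smul_of_le_jacobson_bot (I := RingHom.ker φ)
      Module.Finite.fg_top (hkm.trans (maximalIdeal_le_jacobson _)) fun b _ ↦ ?_
    obtain ⟨n₀, hn₀⟩ := hv₀ (ψ b)
    obtain ⟨n, rfl⟩ := hlift n₀
    rw [← add_sub_cancel (pairMap A v n) b]
    refine Submodule.add_mem_sup ⟨n, rfl⟩ (hsmul _ ?_)
    rw [map_sub, hcomp, hn₀, sub_self]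
  obtain ⟨n₁, n₂, hN⟩ : ∃ n₁ n₂, LinearMap.ker (pairMap A v) = Submodule.span A {n₁, n₂} := by
    refine exists_span_pair_of_surjective φ hφ hkm _ _ ?_ ?_ ?_ hN₀
    · intro n hn
      rw [LinearMap.mem_ker] at hn ⊢
      rw [← hcomp, hn, map_zero]
    · intro n₀ hn₀
      obtain ⟨n, rfl⟩ := hlift n₀
      rw [LinearMap.mem_ker, ← hcomp] at hn₀
      -- A lift of a relation over `A₀` maps into `ker φ • B`, which is the image of `ker φ • A²`.
      -- Subtracting a preimage `m` there yields a relation with the same reduction.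
      obtain ⟨m, hm, hmn⟩ : pairMap A v n ∈
          (RingHom.ker φ • (⊤ : Submodule A (Fin 2 → A))).map (pairMap A v) := by
        rw [Submodule.map_smul'', Submodule.map_top, LinearMap.range_eq_top.2 hv]
        exact hsmul _ hn₀
      refine ⟨n - m, by simp [hmn], ?_⟩
      have hm0 : φ ∘ m = 0 := by
        refine Submodule.smul_induction_on hm (fun r hr x _ ↦ ?_) fun x y hx hy ↦ ?_
        · ext k; simp [RingHom.mem_ker.1 hr]
        · ext k
          have h1 := congr_fun hx k
          have h2 := congr_fun hy k
          simp only [Function.comp_apply, Pi.zero_apply] at h1 h2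
          simp [h1, h2]
      ext k
      have := congr_fun hm0 k
      simp only [Function.comp_apply, Pi.zero_apply] at this
      simp [this]
    · intro n hn h0
      rw [hφk]
      refine mem_smul_ker_of_flat I _ hv n hn fun k ↦ ?_
      rw [← hφk]
      exact congr_fun h0 k
  have hcond := span_pair_eq_conductor v hv n₁ n₂ hN
  -- If `1` were in the conductor, `v` would come from `A`, and its reduction `v₀` from `A₀`.
  have hne : Ideal.span {n₁ 1, n₂ 1} ≤ maximalIdeal A := by
    refine le_maximalIdeal fun h ↦ ?_
    rw [Ideal.eq_top_iff_one, hcond] at h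
    obtain ⟨c, hc⟩ := h v
    refine hv₀' (φ c) ?_
    rw [← hφψ, ← hc, map_one, one_mul]
  refine ⟨n₁ 0, n₂ 0, n₁ 1, n₂ 1, ⟨pairMap A v, hv, ?_⟩, hne (Ideal.subset_span (by simp)),
    hne (Ideal.subset_span (by simp)), apply_zero_mem_span_pair v hv n₁ n₂ hN n₁ ?_,
    apply_zero_mem_span_pair v hv n₁ n₂ hN n₂ ?_, hcond⟩
  · rw [hN, Matrix.range_mulVecLin]
    congr 1
    have h₁ : Matrix.col !![n₁ 0, n₂ 0; n₁ 1, n₂ 1] 0 = n₁ := by ext k; fin_cases k <;> rfl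
    have h₂ : Matrix.col !![n₁ 0, n₂ 0; n₁ 1, n₂ 1] 1 = n₂ := by ext k; fin_cases k <;> rfl
    ext x
    simp [Fin.exists_fin_two, h₁, h₂, eq_comm]
  · rw [hN]; exact Submodule.subset_span (by simp)
  · rw [hN]; exact Submodule.subset_span (by simp)

end Algebra

/-! ### Stalks of direct images under affine morphisms and closed immersions. -/

section PushforwardStalk

open TopologicalSpace Opposite

variable {X Y : Scheme.{u}} (i : X ⟶ Y)

/-- The germ at `y` of a section of `i_* 𝒪_X` over `U`. -/
def pushforwardGerm (U : Y.Opens) (y : Y) (hy : y ∈ U) : Γ(X, i ⁻¹ᵁ U) →+* PushforwardStalk i y :=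
  ((i.base _* X.presheaf).germ U y hy).hom

lemma algebraMap_germ (U : Y.Opens) (y : Y) (hy : y ∈ U) (c : Γ(Y, U)) :
    algebraMap (Y.presheaf.stalk y) (PushforwardStalk i y) (Y.presheaf.germ U y hy c) =
      pushforwardGerm i U y hy (i.app U c) :=
  TopCat.Presheaf.stalkFunctor_map_germ_apply (C := CommRingCat.{u}) U y hy i.c c

lemma pushforwardGerm_res {U V : Y.Opens} (h : V ≤ U) (y : Y) (hy : y ∈ V) (e : Γ(X, i ⁻¹ᵁ U)) :
    pushforwardGerm i V y hy (X.presheaf.map (homOfLE ((Opens.map i.base).monotone h)).op e) =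
      pushforwardGerm i U y (h hy) e :=
  TopCat.Presheaf.germ_res_apply (C := CommRingCat.{u}) (i.base _* X.presheaf) (homOfLE h) y hy e

lemma exists_pushforwardGerm_eq (y : Y) (b : PushforwardStalk i y) :
    ∃ (U : Y.Opens) (hy : y ∈ U) (e : Γ(X, i ⁻¹ᵁ U)), pushforwardGerm i U y hy e = b :=
  TopCat.Presheaf.exists_germ_eq (C := CommRingCat.{u}) (i.base _* X.presheaf) b

lemma exists_res_eq_of_pushforwardGerm_eq (U : Y.Opens) (y : Y) (hy : y ∈ U)
    (e e' : Γ(X, i ⁻¹ᵁ U)) (h : pushforwardGerm i U y hy e = pushforwardGerm i U y hy e') :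
    ∃ (V : Y.Opens) (hVU : V ≤ U), y ∈ V ∧
      X.presheaf.map (homOfLE ((Opens.map i.base).monotone hVU)).op e =
        X.presheaf.map (homOfLE ((Opens.map i.base).monotone hVU)).op e' := by
  obtain ⟨V, hyV, i₁, i₂, hV⟩ :=
    TopCat.Presheaf.germ_eq (C := CommRingCat.{u}) (i.base _* X.presheaf) y hy hy e e' h
  exact ⟨V, i₁.le, hyV, hV⟩

lemma mem_primeCompl_primeIdealOf {U : Y.Opens} (hU : IsAffineOpen U) (y : Y) (hy : y ∈ U)
    (c : Γ(Y, U)) : c ∈ (hU.primeIdealOf ⟨y, hy⟩).asIdeal.primeCompl ↔ y ∈ Y.basicOpen c := by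
  let := Y.presheaf.algebra_section_stalk ⟨y, hy⟩
  have := hU.isLocalization_stalk ⟨y, hy⟩
  rw [Y.mem_basicOpen c y hy]
  exact (IsLocalization.AtPrime.isUnit_to_map_iff (Y.presheaf.stalk y)
    (hU.primeIdealOf ⟨y, hy⟩).asIdeal c).symm

/-- For an affine morphism `i : X ⟶ Y` and an affine neighbourhood `U` of `y`, the stalk
`(i_* 𝒪_X)_y` is the localization of `Γ(X, i⁻¹ U)` at the image of the complement of the prime
ideal of `y`. -/
theorem isLocalization_pushforwardGerm [IsAffineHom i] {U : Y.Opens} (hU : IsAffineOpen U) (y : Y)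
    (hy : y ∈ U) :
    @IsLocalization _ _ ((hU.primeIdealOf ⟨y, hy⟩).asIdeal.primeCompl.map (i.app U).hom)
      (PushforwardStalk i y) _ (pushforwardGerm i U y hy).toAlgebra := by
  let := (pushforwardGerm i U y hy).toAlgebra
  have hW : IsAffineOpen (i ⁻¹ᵁ U) := hU.preimage i
  have hpre (c : Γ(Y, U)) : i ⁻¹ᵁ (Y.basicOpen c) = X.basicOpen (i.app U c) :=
    Scheme.preimage_basicOpen i c
  have hle (c : Γ(Y, U)) : i ⁻¹ᵁ (Y.basicOpen c) ≤ i ⁻¹ᵁ U :=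
    (Opens.map i.base).monotone (Y.basicOpen_le c)
  refine (isLocalization_iff _ _).2 ⟨?_, ?_, ?_⟩
  · rintro ⟨_, c, hc, rfl⟩
    replace hc := (mem_primeCompl_primeIdealOf hU y hy c).1 hc
    rw [Y.mem_basicOpen c y hy] at hc
    have := hc.map (algebraMap (Y.presheaf.stalk y) (PushforwardStalk i y))
    rwa [algebraMap_germ] at this
  · intro b
    obtain ⟨V, hyV, σ, rfl⟩ := exists_pushforwardGerm_eq i y b
    -- Shrinking to a basic open set of `U` makes the sections a localization at powers of `i.app U
    -- c`, so denominators can be cleared.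
    obtain ⟨c, hcV, hyc⟩ := hU.exists_basicOpen_le ⟨y, hyV⟩ hy
    rw [← pushforwardGerm_res i hcV y hyc]
    generalize X.presheaf.map _ σ = τ
    let := (X.presheaf.map (homOfLE (hle c)).op).hom.toAlgebra
    have := hW.isLocalization_of_eq_basicOpen (i.app U c) (homOfLE (hle c)) (hpre c)
    obtain ⟨⟨e, ⟨_, n, rfl⟩⟩, he⟩ := IsLocalization.surj (Submonoid.powers (i.app U c)) τ
    refine ⟨⟨e, ⟨_, c ^ n, (mem_primeCompl_primeIdealOf hU y hy _).2 ?_, rfl⟩⟩, ?_⟩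
    · rw [Y.mem_basicOpen _ y hy, map_pow]
      exact ((Y.mem_basicOpen _ y hy).1 hyc).pow n
    · change _ * pushforwardGerm i U y hy (i.app U (c ^ n)) = pushforwardGerm i U y hy e
      rw [← pushforwardGerm_res i (Y.basicOpen_le c) y hyc e,
        ← pushforwardGerm_res i (Y.basicOpen_le c) y hyc (i.app U (c ^ n)), ← map_mul]
      congr 1
      rw [map_pow]
      exact he
  · intro e e' h
    obtain ⟨V, hVU, hyV, hV⟩ := exists_res_eq_of_pushforwardGerm_eq i U y hy e e' h
    obtain ⟨c, hcV, hyc⟩ := hU.exists_basicOpen_le ⟨y, hyV⟩ hy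
    let := (X.presheaf.map (homOfLE (hle c)).op).hom.toAlgebra
    have := hW.isLocalization_of_eq_basicOpen (i.app U c) (homOfLE (hle c)) (hpre c)
    have hres : algebraMap Γ(X, i ⁻¹ᵁ U) Γ(X, i ⁻¹ᵁ (Y.basicOpen c)) e =
        algebraMap Γ(X, i ⁻¹ᵁ U) Γ(X, i ⁻¹ᵁ (Y.basicOpen c)) e' := by
      have := congr_arg (X.presheaf.map (homOfLE ((Opens.map i.base).monotone hcV)).op) hV
      simp only [← CommRingCat.comp_apply, ← Functor.map_comp, ← op_comp] at this
      exact this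
    obtain ⟨⟨_, n, rfl⟩, hn⟩ := IsLocalization.exists_of_eq
      (M := Submonoid.powers (i.app U c)) hres
    refine ⟨⟨_, c ^ n, (mem_primeCompl_primeIdealOf hU y hy _).2 ?_, rfl⟩, ?_⟩
    · rw [Y.mem_basicOpen _ y hy, map_pow]
      exact ((Y.mem_basicOpen _ y hy).1 hyc).pow n
    · change i.app U (c ^ n) * e = i.app U (c ^ n) * e'
      rw [map_pow]
      exact hn

/-- For a morphism `f` followed by a closed immersion `ι`, the stalks of the direct images of
`𝒪_X` under `f ≫ ι` and `f` agree. -/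
theorem exists_pushforwardStalk_ringEquiv {X Z Y : Scheme.{u}} (f : X ⟶ Z) (ι : Z ⟶ Y)
    [IsClosedImmersion ι] (i : X ⟶ Y) (hi : f ≫ ι = i) (η : Z) :
    ∃ e : PushforwardStalk i (ι η) ≃+* PushforwardStalk f η,
      ∀ a, e (algebraMap _ _ a) = algebraMap _ _ (ι.stalkMap η a) := by
  subst hi
  have : IsIso ((f.base _* X.presheaf).stalkPushforward CommRingCat.{u} ι.base η) :=
    TopCat.Presheaf.stalkPushforward.stalkPushforward_iso_of_isInducing CommRingCat.{u}
      ι.isClosedEmbedding.isInducing _ η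
  let e : PushforwardStalk (f ≫ ι) (ι η) ≃+* PushforwardStalk f η :=
    (asIso ((f.base _* X.presheaf).stalkPushforward
      CommRingCat.{u} ι.base η)).commRingCatIsoToRingEquiv
  have he (U : Y.Opens) (hU : ι η ∈ U) (c : Γ(X, (f ≫ ι) ⁻¹ᵁ U)) :
      e (pushforwardGerm (f ≫ ι) U (ι η) hU c) = pushforwardGerm f (ι ⁻¹ᵁ U) η hU c :=
    congr($(TopCat.Presheaf.stalkPushforward_germ CommRingCat.{u} ι.base
      (f.base _* X.presheaf) U η hU) c)
  refine ⟨e, fun a ↦ ?_⟩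
  obtain ⟨U, hU, c, rfl⟩ := TopCat.Presheaf.exists_germ_eq Y.presheaf a
  have h₁ := algebraMap_germ (f ≫ ι) U (ι η) hU c
  have h₂ : ι.stalkMap η (Y.presheaf.germ U (ι η) hU c) =
      Z.presheaf.germ (ι ⁻¹ᵁ U) η hU (ι.app U c) := Scheme.Hom.germ_stalkMap_apply ..
  have h₃ := algebraMap_germ f (ι ⁻¹ᵁ U) η hU (ι.app U c)
  have h₄ : (f ≫ ι).app U c = f.app (ι ⁻¹ᵁ U) (ι.app U c) :=
    congr($(Scheme.Hom.comp_app f ι U) c)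
  refine (congr_arg e h₁).trans ((he U hU _).trans ?_)
  rw [h₄, ← h₃]
  exact congr_arg _ h₂.symm

end PushforwardStalk

/-! ### Passage to a closed fibre and lifting presentations from it. -/

section Fibre

open TopologicalSpace Opposite

/-- The pushout of a surjective ring homomorphism is a quotient by the extended kernel. -/
lemma surjective_and_ker_eq_of_isPushout {S T C P : CommRingCat.{u}} {f : S ⟶ C} {g : S ⟶ T}
    {inl : C ⟶ P} {inr : T ⟶ P} (h : IsPushout f g inl inr) (hg : Function.Surjective g.hom) :
    Function.Surjective inl.hom ∧
      RingHom.ker inl.hom = (RingHom.ker g.hom).map f.hom := by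
  let J : Ideal C := (RingHom.ker g.hom).map f.hom
  let μ : C ⟶ CommRingCat.of (C ⧸ J) := CommRingCat.ofHom (Ideal.Quotient.mk J)
  have hle : RingHom.ker g.hom ≤ RingHom.ker ((Ideal.Quotient.mk J).comp f.hom) := fun s hs ↦
    Ideal.Quotient.eq_zero_iff_mem.2 (Ideal.mem_map_of_mem _ hs)
  let τ : T ⟶ CommRingCat.of (C ⧸ J) := CommRingCat.ofHom
    (RingHom.liftOfSurjective g.hom hg ⟨(Ideal.Quotient.mk J).comp f.hom, hle⟩)
  have hμτ : f ≫ μ = g ≫ τ := by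
    ext s
    exact (RingHom.liftOfRightInverse_comp_apply g.hom _ (Function.rightInverse_surjInv hg)
      ⟨(Ideal.Quotient.mk J).comp f.hom, hle⟩ s).symm
  have hJ : J ≤ RingHom.ker inl.hom := by
    refine Ideal.map_le_iff_le_comap.2 fun s hs ↦ ?_
    have : inl (f s) = inr (g s) := congr($(h.w) s)
    rw [Ideal.mem_comap, RingHom.mem_ker]
    refine this.trans ?_
    rw [show g s = 0 from hs, map_zero]
  let ν : CommRingCat.of (C ⧸ J) ⟶ P := CommRingCat.ofHom (Ideal.Quotient.lift J inl.hom hJ)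
  have hμν : μ ≫ ν = inl := by ext c; rfl
  -- This identity gives surjectivity of `inl`; the kernel follows by applying `h.desc μ τ hμτ` to
  -- `inl c = 0`.
  have hid : h.desc μ τ hμτ ≫ ν = 𝟙 P := by
    refine h.hom_ext ?_ ?_
    · rw [h.inl_desc_assoc, hμν, Category.comp_id]
    · rw [h.inr_desc_assoc, Category.comp_id]
      have : Epi g := ConcreteCategory.epi_of_surjective g hg
      rw [← cancel_epi g, ← reassoc_of% hμτ, hμν, h.w]
  refine ⟨fun p ↦ ?_, le_antisymm (fun c hc ↦ ?_) hJ⟩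
  · obtain ⟨c, hc⟩ := Ideal.Quotient.mk_surjective (h.desc μ τ hμτ p)
    refine ⟨c, ?_⟩
    have h₁ : ν (h.desc μ τ hμτ p) = p := congr($hid p)
    rw [← hc] at h₁
    exact h₁
  · have h₁ : h.desc μ τ hμτ (inl c) = μ c := congr($(h.inl_desc μ τ hμτ) c)
    rw [show inl c = 0 from hc, map_zero] at h₁
    exact Ideal.Quotient.eq_zero_iff_mem.1 h₁.symm

/-- The localization of a surjective ring homomorphism. -/
lemma exists_localization_surjective {S S₀ L L₀ : Type*} [CommRing S] [CommRing S₀] [CommRing L]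
    [CommRing L₀] [Algebra S L] [Algebra S₀ L₀] (φ : S →+* S₀) (hφ : Function.Surjective φ)
    (M : Submonoid S) (M₀ : Submonoid S₀) (hM : M.map φ = M₀) [IsLocalization M L]
    [IsLocalization M₀ L₀] :
    ∃ Φ : L →+* L₀, Function.Surjective Φ ∧
      RingHom.ker Φ = (RingHom.ker φ).map (algebraMap S L) ∧
      ∀ s, Φ (algebraMap S L s) = algebraMap S₀ L₀ (φ s) := by
  subst hM
  exact ⟨IsLocalization.map L₀ φ M.le_comap_map,
    IsLocalization.map_surjective_of_surjective M L L₀ hφ,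
    IsLocalization.ker_map L₀ φ rfl, fun s ↦ IsLocalization.map_eq _ s⟩

variable {R : Type u} [CommRing R]

/-- The ring homomorphism `R → Γ(Y, U)` of a scheme `Y` over `Spec R`. -/
def structureHom {Y : Scheme.{u}} (q : Y ⟶ Spec (CommRingCat.of R)) (U : Y.Opens) :
    R →+* Γ(Y, U) :=
  ((Scheme.ΓSpecIso (CommRingCat.of R)).inv ≫ q.appLE ⊤ U (show U ≤ q ⁻¹ᵁ ⊤ from le_top)).hom

lemma structureHom_comp {X Y : Scheme.{u}} (i : X ⟶ Y) (q : Y ⟶ Spec (CommRingCat.of R))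
    (U : Y.Opens) :
    structureHom (i ≫ q) (i ⁻¹ᵁ U) = (i.app U).hom.comp (structureHom q U) := by
  rw [structureHom, structureHom, ← CommRingCat.hom_comp, Category.assoc,
    Scheme.Hom.app_eq_appLE, Scheme.Hom.appLE_comp_appLE]

lemma flat_structureHom {X : Scheme.{u}} (q : X ⟶ Spec (CommRingCat.of R)) [Flat q]
    {U : X.Opens} (hU : IsAffineOpen U) : (structureHom q U).Flat := by
  rw [structureHom, CommRingCat.hom_comp]
  refine RingHom.Flat.comp ?_
    (HasRingHomProperty.appLE @Flat q inferInstance ⟨⊤, isAffineOpen_top _⟩ ⟨U, hU⟩ le_top)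
  exact RingHom.Flat.of_bijective
    (ConcreteCategory.bijective_of_isIso (Scheme.ΓSpecIso (CommRingCat.of R)).inv)

variable {K : Type u} [CommRing K] (θ : R →+* K) {Y : Scheme.{u}}
  (q : Y ⟶ Spec (CommRingCat.of R))

/-- The inclusion of the fibre over `Spec K → Spec R`. -/
abbrev fibreInclusion :
    pullback q (Spec.map (CommRingCat.ofHom θ)) ⟶ Y :=
  pullback.fst q (Spec.map (CommRingCat.ofHom θ))

/-- Over an affine open set the fibre product is a pushout of rings, and pushing out the surjection
`θ` is passing to the quotient by the ideal that `ker θ` generates. -/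
lemma fibreInclusion_app (hθ : Function.Surjective θ) {U : Y.Opens} (hU : IsAffineOpen U) :
    Function.Surjective ((fibreInclusion θ q).app U).hom ∧
      RingHom.ker ((fibreInclusion θ q).app U).hom = (RingHom.ker θ).map (structureHom q U) := by
  have H := IsPullback.of_hasPullback q (Spec.map (CommRingCat.ofHom θ))
  have h₁ := (isIso_pushoutSection_iff H (US := ⊤) (UT := ⊤) (UX := U)
    (UY := (fibreInclusion θ q) ⁻¹ᵁ U) le_top le_top (by simp)).1
    (isIso_pushoutSection_of_isAffineOpen H _ _ _ (isAffineOpen_top _) (isAffineOpen_top _) hU)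
  have hx : (Spec.map (CommRingCat.ofHom θ)).appLE ⊤ ⊤ le_top =
      (Scheme.ΓSpecIso (CommRingCat.of R)).hom ≫ CommRingCat.ofHom θ ≫
        (Scheme.ΓSpecIso (CommRingCat.of K)).inv := by
    rw [← Scheme.ΓSpecIso_naturality_assoc, Iso.hom_inv_id, Category.comp_id]
    exact (Scheme.Hom.app_eq_appLE _).symm
  have hbK := ConcreteCategory.bijective_of_isIso (Scheme.ΓSpecIso (CommRingCat.of K)).inv
  have hbR := ConcreteCategory.bijective_of_isIso (Scheme.ΓSpecIso (CommRingCat.of R)).hom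
  have hsurj : Function.Surjective
      ((Spec.map (CommRingCat.ofHom θ)).appLE ⊤ ⊤ le_top).hom := by
    rw [hx]
    exact hbK.2.comp (hθ.comp hbR.2)
  obtain ⟨h₂, h₃⟩ := surjective_and_ker_eq_of_isPushout h₁ hsurj
  rw [← Scheme.Hom.app_eq_appLE] at h₂ h₃
  refine ⟨h₂, h₃.trans ?_⟩
  have hker : RingHom.ker ((Spec.map (CommRingCat.ofHom θ)).appLE ⊤ ⊤ le_top).hom =
      (RingHom.ker θ).map (Scheme.ΓSpecIso (CommRingCat.of R)).inv.hom := by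
    refine le_antisymm (fun a ha ↦ ?_) (Ideal.map_le_iff_le_comap.2 fun r hr ↦ ?_)
    · have hinv : (Scheme.ΓSpecIso (CommRingCat.of R)).inv
          ((Scheme.ΓSpecIso (CommRingCat.of R)).hom a) = a :=
        congr($((Scheme.ΓSpecIso (CommRingCat.of R)).hom_inv_id) a)
      rw [← hinv]
      refine Ideal.mem_map_of_mem (Scheme.ΓSpecIso (CommRingCat.of R)).inv.hom ?_
      rw [hx] at ha
      exact hbK.1 ((RingHom.mem_ker.1 ha).trans (map_zero _).symm)
    · rw [Ideal.mem_comap, RingHom.mem_ker, hx]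
      have hinv : (Scheme.ΓSpecIso (CommRingCat.of R)).hom
          ((Scheme.ΓSpecIso (CommRingCat.of R)).inv r) = r :=
        congr($((Scheme.ΓSpecIso (CommRingCat.of R)).inv_hom_id) r)
      change (Scheme.ΓSpecIso (CommRingCat.of K)).inv (θ ((Scheme.ΓSpecIso (CommRingCat.of R)).hom
          ((Scheme.ΓSpecIso (CommRingCat.of R)).inv r))) = 0
      rw [hinv, RingHom.mem_ker.1 hr, map_zero]
  rw [hker, Ideal.map_map]
  rfl

/-- The map `Γ(X, i⁻¹ U) → Γ(X₀, i₀⁻¹ U₀)` to the fibre `i₀ : X₀ ⟶ Y₀` of `i : X ⟶ Y`. -/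
def fibreAppLE {X Y Y₀ : Scheme.{u}} (i : X ⟶ Y) (j : Y₀ ⟶ Y) (U : Y.Opens) :
    Γ(X, i ⁻¹ᵁ U) ⟶ Γ(pullback i j, pullback.snd i j ⁻¹ᵁ (j ⁻¹ᵁ U)) :=
  (pullback.fst i j).appLE _ _ (by
    rw [← Scheme.Hom.comp_preimage, ← Scheme.Hom.comp_preimage, pullback.condition])

lemma app_fibreAppLE {X Y Y₀ : Scheme.{u}} (i : X ⟶ Y) (j : Y₀ ⟶ Y) (U : Y.Opens) :
    i.app U ≫ fibreAppLE i j U = j.app U ≫ (pullback.snd i j).app (j ⁻¹ᵁ U) := by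
  simp only [fibreAppLE, Scheme.Hom.app_eq_appLE, Scheme.Hom.appLE_comp_appLE,
    pullback.condition]

lemma fibreAppLE_surjective_and_ker {X Y Y₀ : Scheme.{u}} (i : X ⟶ Y) (j : Y₀ ⟶ Y)
    [IsAffineHom i] [IsAffineHom j] {U : Y.Opens} (hU : IsAffineOpen U)
    (hj : Function.Surjective (j.app U).hom) :
    Function.Surjective (fibreAppLE i j U).hom ∧
      RingHom.ker (fibreAppLE i j U).hom = (RingHom.ker (j.app U).hom).map (i.app U).hom := by
  have H := IsPullback.of_hasPullback i j
  have h₁ := (isIso_pushoutSection_iff H (US := U) (UT := j ⁻¹ᵁ U) (UX := i ⁻¹ᵁ U)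
    (UY := pullback.snd i j ⁻¹ᵁ (j ⁻¹ᵁ U)) le_rfl le_rfl (by
      rw [← Scheme.Hom.comp_preimage, ← Scheme.Hom.comp_preimage, pullback.condition,
        inf_idem])).1
    (isIso_pushoutSection_of_isAffineOpen H _ _ _ hU (hU.preimage j) (hU.preimage i))
  have := surjective_and_ker_eq_of_isPushout h₁ (by
    rwa [← Scheme.Hom.app_eq_appLE])
  rwa [← Scheme.Hom.app_eq_appLE, ← Scheme.Hom.app_eq_appLE] at this

lemma map_primeCompl_primeIdealOf {Y Y₀ : Scheme.{u}} (j : Y₀ ⟶ Y) [IsAffineHom j]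
    {U : Y.Opens} (hU : IsAffineOpen U) (hj : Function.Surjective (j.app U).hom) (P : Y₀)
    (hP : j P ∈ U) :
    (hU.primeIdealOf ⟨j P, hP⟩).asIdeal.primeCompl.map (j.app U).hom =
      ((hU.preimage j).primeIdealOf ⟨P, hP⟩).asIdeal.primeCompl := by
  have key (c : Γ(Y, U)) : c ∈ (hU.primeIdealOf ⟨j P, hP⟩).asIdeal.primeCompl ↔
      j.app U c ∈ ((hU.preimage j).primeIdealOf ⟨P, hP⟩).asIdeal.primeCompl := by
    refine (mem_primeCompl_primeIdealOf hU (j P) hP c).trans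
      (Iff.trans ?_ (mem_primeCompl_primeIdealOf (hU.preimage j) P hP (j.app U c)).symm)
    rw [← Scheme.preimage_basicOpen]
    rfl
  ext c₀
  obtain ⟨c, rfl⟩ := hj c₀
  constructor
  · rintro ⟨d, hd, hdc⟩
    rw [← hdc]
    exact (key d).1 hd
  · exact fun h ↦ ⟨c, (key c).2 h, rfl⟩

/-- Presentations of `(i_* 𝒪_X)_ξ` from presentations on a fibre of the flat family `X`. -/
theorem exists_presentation_of_fibre (hθ : Function.Surjective θ) {X : Scheme.{u}} (i : X ⟶ Y)
    [IsFinite i] [Flat (i ≫ q)] {U : Y.Opens} (hU : IsAffineOpen U) [IsNoetherianRing Γ(Y, U)]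
    (P : ↥(pullback q (Spec.map (CommRingCat.ofHom θ)))) (hP : fibreInclusion θ q P ∈ U)
    (v₀ : PushforwardStalk (pullback.snd i (fibreInclusion θ q)) P)
    (hv₀ : Function.Surjective (pairMap
      ((pullback q (Spec.map (CommRingCat.ofHom θ))).presheaf.stalk P) v₀))
    (hv₀' : ∀ a₀ : (pullback q (Spec.map (CommRingCat.ofHom θ))).presheaf.stalk P,
      algebraMap _ (PushforwardStalk (pullback.snd i (fibreInclusion θ q)) P) a₀ ≠ v₀)
    (hN₀ : ∃ n₁ n₂, LinearMap.ker (pairMap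
        ((pullback q (Spec.map (CommRingCat.ofHom θ))).presheaf.stalk P) v₀) =
      Submodule.span _ {n₁, n₂}) :
    ∃ g f s t : Y.presheaf.stalk (fibreInclusion θ q P),
      (∃ π : (Fin 2 → Y.presheaf.stalk (fibreInclusion θ q P)) →ₗ[
          Y.presheaf.stalk (fibreInclusion θ q P)] PushforwardStalk i (fibreInclusion θ q P),
        Function.Surjective π ∧
        LinearMap.ker π = LinearMap.range (!![g, f; s, t]).mulVecLin) ∧
      s ∈ IsLocalRing.maximalIdeal (Y.presheaf.stalk (fibreInclusion θ q P)) ∧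
      t ∈ IsLocalRing.maximalIdeal (Y.presheaf.stalk (fibreInclusion θ q P)) ∧
      g ∈ Ideal.span {s, t} ∧ f ∈ Ideal.span {s, t} ∧
      ∀ a, a ∈ Ideal.span {s, t} ↔ ∀ b : PushforwardStalk i (fibreInclusion θ q P),
        ∃ c, algebraMap _ (PushforwardStalk i (fibreInclusion θ q P)) a * b =
          algebraMap (Y.presheaf.stalk (fibreInclusion θ q P)) _ c := by
  have : IsClosedImmersion (Spec.map (CommRingCat.ofHom θ)) :=
    IsClosedImmersion.spec_of_surjective _ hθ
  generalize hj : fibreInclusion θ q = j at *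
  have : IsClosedImmersion j := by rw [← hj]; infer_instance
  have hjapp : Function.Surjective (j.app U).hom ∧
      RingHom.ker (j.app U).hom = (RingHom.ker θ).map (structureHom q U) := by
    subst hj; exact fibreInclusion_app θ q hθ hU
  -- From here on, only surjectivity and the kernel of `j.app U` matter, so `Y₀` can be made an
  -- arbitrary closed subscheme of `Y`.
  clear hj
  generalize pullback q (Spec.map (CommRingCat.ofHom θ)) = Y₀ at *
  obtain ⟨hjs, hjk⟩ := hjapp
  obtain ⟨hes, hek⟩ := fibreAppLE_surjective_and_ker i j hU hjs
  let M := (hU.primeIdealOf ⟨j P, hP⟩).asIdeal.primeCompl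
  let M₀ := ((hU.preimage j).primeIdealOf ⟨P, hP⟩).asIdeal.primeCompl
  have hM : M.map (j.app U).hom = M₀ := map_primeCompl_primeIdealOf j hU hjs P hP
  let A := Y.presheaf.stalk (j P)
  let B := PushforwardStalk i (j P)
  let A₀ := Y₀.presheaf.stalk P
  let B₀ := PushforwardStalk (pullback.snd i j) P
  let i₀ := pullback.snd i j
  let : Algebra R Γ(Y, U) := (structureHom q U).toAlgebra
  let : Algebra Γ(Y, U) Γ(X, i ⁻¹ᵁ U) := (i.app U).hom.toAlgebra
  let : Algebra Γ(Y, U) A := Y.presheaf.algebra_section_stalk ⟨j P, hP⟩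
  let : Algebra Γ(X, i ⁻¹ᵁ U) B := (pushforwardGerm i U (j P) hP).toAlgebra
  let : Algebra Γ(Y, U) B := ((pushforwardGerm i U (j P) hP).comp (i.app U).hom).toAlgebra
  let : Algebra R A := ((algebraMap Γ(Y, U) A).comp (structureHom q U)).toAlgebra
  let : Algebra R B := ((algebraMap A B).comp (algebraMap R A)).toAlgebra
  let : Algebra Γ(Y₀, j ⁻¹ᵁ U) A₀ := Y₀.presheaf.algebra_section_stalk ⟨P, hP⟩
  let : Algebra Γ(pullback i j, i₀ ⁻¹ᵁ (j ⁻¹ᵁ U)) B₀ :=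
    (pushforwardGerm i₀ (j ⁻¹ᵁ U) P hP).toAlgebra
  have : IsScalarTower R A B := .of_algebraMap_eq' rfl
  have : IsScalarTower Γ(Y, U) Γ(X, i ⁻¹ᵁ U) B := .of_algebraMap_eq' rfl
  have hAB : (algebraMap A B).comp (algebraMap Γ(Y, U) A) = algebraMap Γ(Y, U) B :=
    RingHom.ext fun c ↦ algebraMap_germ i U (j P) hP c
  have : IsScalarTower Γ(Y, U) A B := .of_algebraMap_eq' hAB.symm
  have : IsLocalization M A := hU.isLocalization_stalk ⟨j P, hP⟩
  have : IsLocalization M₀ A₀ := (hU.preimage j).isLocalization_stalk ⟨P, hP⟩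
  have : IsLocalization (M.map (i.app U).hom) B := isLocalization_pushforwardGerm i hU (j P) hP
  have : IsLocalization (Algebra.algebraMapSubmonoid Γ(X, i ⁻¹ᵁ U) M) B := this
  have : IsLocalization (M₀.map (i₀.app (j ⁻¹ᵁ U)).hom) B₀ :=
    isLocalization_pushforwardGerm i₀ (hU.preimage j) P hP
  have : Module.Finite Γ(Y, U) Γ(X, i ⁻¹ᵁ U) := i.finite_app U hU
  have : Module.Finite A B := .of_isLocalization Γ(Y, U) Γ(X, i ⁻¹ᵁ U) M
  have : IsNoetherianRing A := IsLocalization.isNoetherianRing M A inferInstance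
  have hw : (fibreAppLE i j U).hom.comp (i.app U).hom =
      (i₀.app (j ⁻¹ᵁ U)).hom.comp (j.app U).hom := congr($(app_fibreAppLE i j U).hom)
  have hMM : (M.map (i.app U).hom).map (fibreAppLE i j U).hom =
      M₀.map (i₀.app (j ⁻¹ᵁ U)).hom := by
    rw [← hM]
    ext x
    simp only [Submonoid.mem_map, exists_exists_and_eq_and]
    exact exists_congr fun c ↦ and_congr_right fun _ ↦
      (RingHom.congr_fun hw c).congr_left
  obtain ⟨φ, hφ, hφk, hφc⟩ := exists_localization_surjective (L := A) (L₀ := A₀)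
    (j.app U).hom hjs M M₀ hM
  obtain ⟨ψ, hψ, hψk, hψc⟩ := exists_localization_surjective (L := B) (L₀ := B₀)
    (fibreAppLE i j U).hom hes (M.map (i.app U).hom) _ hMM
  -- `B` is a localization of `Γ(X, i⁻¹U)`, which is flat over `R`; the `R`-structure of `B` was
  -- defined through `A`, so the two structures have to be compared.
  have hflat : Module.Flat R B := by
    let : Algebra R Γ(X, i ⁻¹ᵁ U) := (structureHom (i ≫ q) (i ⁻¹ᵁ U)).toAlgebra
    have : Module.Flat R Γ(X, i ⁻¹ᵁ U) := flat_structureHom (i ≫ q) (hU.preimage i)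
    have : Module.Flat Γ(X, i ⁻¹ᵁ U) B := IsLocalization.flat B (M.map (i.app U).hom)
    have : IsScalarTower R Γ(X, i ⁻¹ᵁ U) B := .of_algebraMap_eq' (by
      change (algebraMap A B).comp ((algebraMap Γ(Y, U) A).comp (structureHom q U)) =
        (pushforwardGerm i U (j P) hP).comp (structureHom (i ≫ q) (i ⁻¹ᵁ U))
      rw [← RingHom.comp_assoc, hAB, structureHom_comp]
      rfl)
    exact Module.Flat.trans R Γ(X, i ⁻¹ᵁ U) B
  have hψφ : ψ.comp (algebraMap A B) = (algebraMap A₀ B₀).comp φ := by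
    refine IsLocalization.ringHom_ext M (RingHom.ext fun c ↦ ?_)
    have h₁ : algebraMap A B (algebraMap Γ(Y, U) A c) =
      algebraMap Γ(X, i ⁻¹ᵁ U) B (i.app U c) := RingHom.congr_fun hAB c
    have h₂ : algebraMap A₀ B₀ (algebraMap Γ(Y₀, j ⁻¹ᵁ U) A₀ (j.app U c)) =
      algebraMap Γ(pullback i j, i₀ ⁻¹ᵁ (j ⁻¹ᵁ U)) B₀ (i₀.app (j ⁻¹ᵁ U) (j.app U c)) :=
        algebraMap_germ i₀ (j ⁻¹ᵁ U) P hP _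
    have h₃ : fibreAppLE i j U (i.app U c) = i₀.app (j ⁻¹ᵁ U) (j.app U c) :=
      RingHom.congr_fun hw c
    change ψ (algebraMap A B (algebraMap Γ(Y, U) A c)) =
      algebraMap A₀ B₀ (φ (algebraMap Γ(Y, U) A c))
    rw [h₁, hφc]
    refine (hψc _).trans (Eq.trans ?_ h₂.symm)
    exact congr_arg _ h₃
  refine exists_presentation (RingHom.ker θ) φ hφ ?_ ψ hψ ?_ (fun a ↦ RingHom.congr_fun hψφ a)
    v₀ hv₀ hv₀' hN₀
  · rw [hφk, hjk, Ideal.map_map]; rfl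
  · rw [hψk, hek, hjk, Ideal.map_map, Ideal.map_map]
    congr 1
    change ((pushforwardGerm i U (j P) hP).comp (i.app U).hom).comp (structureHom q U) =
      (algebraMap A B).comp ((algebraMap Γ(Y, U) A).comp (structureHom q U))
    rw [← RingHom.comp_assoc, hAB]
    rfl

end Fibre

/-! ### Local rings of the projective plane through its standard charts. -/

section Plane

open TopologicalSpace Opposite HomogeneousLocalization

attribute [local instance] MvPolynomial.gradedAlgebra

/-- The prime ideals of the polynomial ring in two variables over an algebraically closed
field. -/
lemma isMaximal_span_pair_or_span_singleton {K : Type*} [Field K] [IsAlgClosed K]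
    (q : Ideal (MvPolynomial (Fin 2) K)) [hq : q.IsPrime] :
    (q.IsMaximal ∧ ∃ x y, q = Ideal.span {x, y}) ∨ ∃ w, q = Ideal.span {w} := by
  by_cases hm : q.IsMaximal
  · refine Or.inl ⟨hm, ?_⟩
    obtain ⟨pt, hpt⟩ := (MvPolynomial.isMaximal_iff_eq_vanishingIdeal_singleton).1 hm
    let x : MvPolynomial (Fin 2) K := MvPolynomial.X 0 - MvPolynomial.C (pt 0)
    let y : MvPolynomial (Fin 2) K := MvPolynomial.X 1 - MvPolynomial.C (pt 1)
    refine ⟨x, y, le_antisymm (fun p hp ↦ ?_) ?_⟩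
    -- Modulo `x` and `y`, each polynomial equals its value at `pt`.
    · have hxy : Ideal.Quotient.mk (Ideal.span {x, y}) =
          ((Ideal.Quotient.mk (Ideal.span {x, y})).comp MvPolynomial.C).comp
            (MvPolynomial.eval pt) := by
        refine MvPolynomial.ringHom_ext (fun r ↦ by simp) fun l ↦ ?_
        simp only [RingHom.comp_apply, MvPolynomial.eval_X]
        rw [Ideal.Quotient.mk_eq_mk_iff_sub_mem]
        fin_cases l
        · exact Ideal.subset_span (by simp [x])
        · exact Ideal.subset_span (by simp [y])
      rw [hpt, MvPolynomial.mem_vanishingIdeal_singleton_iff] at hp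
      rw [← Ideal.Quotient.eq_zero_iff_mem, hxy]
      have hp' : MvPolynomial.eval pt p = 0 := by simpa using hp
      simp [hp']
    · rw [Ideal.span_le, hpt]
      refine Set.pair_subset ?_ ?_
      · rw [SetLike.mem_coe, MvPolynomial.mem_vanishingIdeal_singleton_iff]; simp [x]
      · rw [SetLike.mem_coe, MvPolynomial.mem_vanishingIdeal_singleton_iff]; simp [y]
  · right
    by_cases h0 : q = ⊥
    · exact ⟨0, by simp [h0]⟩
    obtain ⟨w, hwq, hw⟩ := hq.exists_mem_prime_of_ne_bot h0
    refine ⟨w, ?_⟩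
    have hwp : (Ideal.span {w}).IsPrime := (Ideal.span_singleton_prime hw.ne_zero).2 hw
    have hle : Ideal.span {w} ≤ q := (Ideal.span_singleton_le_iff_mem _).2 hwq
    by_contra hne
    -- The chain `0 < (w) < q < m` would have length three in a ring of dimension two.
    obtain ⟨m, hmm, hqm⟩ := q.exists_le_maximal hq.ne_top
    have h₁ : (⊥ : Ideal (MvPolynomial (Fin 2) K)) < Ideal.span {w} := by
      rw [bot_lt_iff_ne_bot, Ne, Ideal.span_singleton_eq_bot]; exact hw.ne_zero
    have h₂ : Ideal.span {w} < q := lt_of_le_of_ne hle (Ne.symm hne)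
    have h₃ : q < m := lt_of_le_of_ne hqm fun h ↦ hm (h ▸ hmm)
    have e₁ := Ideal.height_add_one_le_of_lt_of_isPrime h₁
    have e₂ := Ideal.height_add_one_le_of_lt_of_isPrime h₂
    have e₃ := Ideal.height_add_one_le_of_lt_of_isPrime h₃
    have hm3 : (3 : ℕ∞) ≤ m.height := by
      refine le_trans ?_ e₃
      refine le_trans ?_ (add_le_add_left e₂ 1)
      refine le_trans ?_ (add_le_add_left (add_le_add_left e₁ 1) 1)
      rw [Ideal.height_bot]
      norm_num
    have hd := m.height_le_ringKrullDim_of_ne_top hmm.ne_top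
    rw [MvPolynomial.ringKrullDim_of_isNoetherianRing, ringKrullDim_eq_zero_of_field,
      Nat.card_fin, zero_add] at hd
    have : ((3 : ℕ∞) : WithBot ℕ∞) ≤ ((2 : ℕ∞) : WithBot ℕ∞) :=
      (WithBot.coe_le_coe.2 hm3).trans hd
    rw [WithBot.coe_le_coe] at this
    exact absurd this (by decide)

/-- The local rings of quotients of `K[u, v]`. -/
lemma maximalIdeal_of_surjective_mvPolynomial {K C A : Type*} [Field K] [IsAlgClosed K]
    [CommRing C] (τ : MvPolynomial (Fin 2) K →+* C) (hτ : Function.Surjective τ)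
    (p : Ideal C) [hp : p.IsPrime] [CommRing A] [Algebra C A] [IsLocalRing A]
    [IsLocalization.AtPrime A p] :
    (p.IsMaximal ∧ ∃ x y, IsLocalRing.maximalIdeal A = Ideal.span {x, y}) ∨
      ∃ w, IsLocalRing.maximalIdeal A = Ideal.span {w} := by
  have hA : IsLocalRing.maximalIdeal A = ((p.comap τ).map τ).map (algebraMap C A) := by
    rw [Ideal.map_comap_of_surjective τ hτ, IsLocalization.AtPrime.map_eq_maximalIdeal p A]
  rcases isMaximal_span_pair_or_span_singleton (p.comap τ) with ⟨hm, x, y, hxy⟩ | ⟨w, hw⟩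
  · refine Or.inl ⟨?_, algebraMap C A (τ x), algebraMap C A (τ y), ?_⟩
    · have := (Ideal.map_eq_top_or_isMaximal_of_surjective τ hτ hm)
      rw [Ideal.map_comap_of_surjective τ hτ] at this
      exact this.resolve_left hp.ne_top
    · rw [hA, hxy, Ideal.map_span, Ideal.map_span, Set.image_pair, Set.image_pair]
  · refine Or.inr ⟨algebraMap C A (τ w), ?_⟩
    rw [hA, hw, Ideal.map_span, Ideal.map_span, Set.image_singleton, Set.image_singleton]

variable (n : ℕ) (R : Type u) [CommRing R]

/-- The standard affine chart `D₊(x_k)` of projective space. -/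
abbrev chart (k : Fin (n + 1)) : (ProjSpace n R).Opens :=
  Proj.basicOpen (MvPolynomial.homogeneousSubmodule (Fin (n + 1)) R) (MvPolynomial.X k)

lemma X_mem_homogeneousSubmodule (k : Fin (n + 1)) :
    (MvPolynomial.X k : MvPolynomial (Fin (n + 1)) R) ∈
      MvPolynomial.homogeneousSubmodule (Fin (n + 1)) R 1 :=
  MvPolynomial.isHomogeneous_X R k

lemma isAffineOpen_chart (k : Fin (n + 1)) : IsAffineOpen (chart n R k) :=
  Proj.isAffineOpen_basicOpen _ _ (X_mem_homogeneousSubmodule n R k) one_pos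

lemma adjoin_range_X :
    Algebra.adjoin (MvPolynomial.homogeneousSubmodule (Fin (n + 1)) R 0)
      (Set.range (MvPolynomial.X : Fin (n + 1) → MvPolynomial (Fin (n + 1)) R)) = ⊤ := by
  rw [eq_top_iff]
  intro p _
  induction p using MvPolynomial.induction_on with
  | C r =>
    exact algebraMap_mem (R := MvPolynomial.homogeneousSubmodule (Fin (n + 1)) R 0) _
      ⟨MvPolynomial.C r, MvPolynomial.isHomogeneous_C _ r⟩
  | add p q hp hq => exact add_mem (hp trivial) (hq trivial)
  | mul_X p l hp => exact mul_mem (hp trivial) (Algebra.subset_adjoin ⟨l, rfl⟩)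

lemma exists_mem_chart (y : ProjSpace n R) : ∃ k, y ∈ chart n R k := by
  have := Proj.iSup_basicOpen_eq_top' (MvPolynomial.homogeneousSubmodule (Fin (n + 1)) R)
    (MvPolynomial.X : Fin (n + 1) → MvPolynomial (Fin (n + 1)) R)
    (fun k ↦ ⟨1, X_mem_homogeneousSubmodule n R k⟩) (adjoin_range_X n R)
  exact Opens.mem_iSup.1 (this ▸ Opens.mem_top y)

/-- The structure homomorphism of the coordinate ring of a standard chart. -/
def toAway (k : Fin (n + 1)) :
    R →+* Away (MvPolynomial.homogeneousSubmodule (Fin (n + 1)) R) (MvPolynomial.X k) :=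
  (fromZeroRingHom (MvPolynomial.homogeneousSubmodule (Fin (n + 1)) R)
    (Submonoid.powers (MvPolynomial.X k))).comp
      (algebraMap R (MvPolynomial.homogeneousSubmodule (Fin (n + 1)) R 0))

/-- The polynomial ring in the affine coordinates `x_l / x_k` of a standard chart. -/
def affineCoordinates (k : Fin (n + 1)) : MvPolynomial (Fin n) R →+*
    Away (MvPolynomial.homogeneousSubmodule (Fin (n + 1)) R) (MvPolynomial.X k) :=
  MvPolynomial.eval₂Hom (toAway n R k) fun l ↦
    Away.mk _ (X_mem_homogeneousSubmodule n R k) 1 (MvPolynomial.X (k.succAbove l))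
      (X_mem_homogeneousSubmodule n R _)

/-- The chart ring is generated over its degree-zero constants by fractions of monomials over powers
of `x_k`, and each of these is a product of the fractions `x_l / x_k`. -/
lemma affineCoordinates_surjective (k : Fin (n + 1)) :
    Function.Surjective (affineCoordinates n R k) := by
  let 𝒜 := MvPolynomial.homogeneousSubmodule (Fin (n + 1)) R
  have hX := X_mem_homogeneousSubmodule n R
  have hfrac (l : Fin (n + 1)) : Away.mk 𝒜 (hX k) 1 (MvPolynomial.X l) (hX l) ∈
      (affineCoordinates n R k).range := by
    rcases Fin.eq_self_or_eq_succAbove k l with rfl | ⟨l, rfl⟩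
    · convert one_mem (affineCoordinates n R l).range
      ext
      simp
    · exact ⟨MvPolynomial.X l, by simp [affineCoordinates, 𝒜]⟩
  let S : Subalgebra (𝒜 0) (Away 𝒜 (MvPolynomial.X k)) :=
    { (affineCoordinates n R k).range with
      algebraMap_mem' := by
        rintro ⟨p, hp⟩
        obtain ⟨r, rfl⟩ : ∃ r, p = MvPolynomial.C r :=
          ⟨_, MvPolynomial.totalDegree_eq_zero_iff_eq_C.1 (by
            simpa using (MvPolynomial.IsHomogeneous.totalDegree_le hp))⟩
        refine ⟨MvPolynomial.C r, ?_⟩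
        simp only [affineCoordinates, MvPolynomial.coe_eval₂Hom, MvPolynomial.eval₂_C]
        rfl }
  have hS : S = ⊤ := by
    rw [eq_top_iff, ← Away.adjoin_mk_prod_pow_eq_top (𝒜 := 𝒜) (hX k) (Fin (n + 1))
      MvPolynomial.X (adjoin_range_X n R) (fun _ ↦ 1) hX, Algebra.adjoin_le_iff]
    rintro _ ⟨a, e, ha, -, rfl⟩
    have : Away.mk 𝒜 (hX k) a (∏ l, MvPolynomial.X l ^ e l)
        (ha ▸ SetLike.prod_pow_mem_graded _ _ _ _ fun l _ ↦ hX l) =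
        ∏ l, Away.mk 𝒜 (hX k) 1 (MvPolynomial.X l) (hX l) ^ e l := by
      apply (show Function.Injective (algebraMap (Away 𝒜 (MvPolynomial.X k))
        (Localization.Away (MvPolynomial.X k : MvPolynomial (Fin (n + 1)) R)))
        from val_injective _)
      simp only [map_pow, map_prod]
      simp only [HomogeneousLocalization.algebraMap_apply, Away.val_mk,
        Localization.mk_pow, Localization.mk_prod]
      congr 1
      ext
      simp only [smul_eq_mul, mul_one] at ha
      simp [Finset.prod_pow_eq_pow_sum, ha]
    rw [this]
    exact prod_mem fun l _ ↦ pow_mem (hfrac l) _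
  intro z
  have : z ∈ S := hS ▸ trivial
  exact this

lemma structureHom_chart (k : Fin (n + 1)) :
    structureHom (ProjSpace.toSpec n R) (chart n R k) =
      (Proj.awayToSection (MvPolynomial.homogeneousSubmodule (Fin (n + 1)) R)
        (MvPolynomial.X k)).hom.comp (toAway n R k) := by
  let 𝒜 := MvPolynomial.homogeneousSubmodule (Fin (n + 1)) R
  have h₁ : (chart n R k).ι ≫ ProjSpace.toSpec n R =
      Proj.basicOpenToSpec 𝒜 (MvPolynomial.X k) ≫
        Spec.map (CommRingCat.ofHom (toAway n R k)) := by
    have := Proj.awayι_toSpecZero 𝒜 (MvPolynomial.X k) (X_mem_homogeneousSubmodule n R k) one_pos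
    rw [Proj.awayι, Category.assoc, Iso.inv_comp_eq, Proj.basicOpenIsoSpec_hom] at this
    rw [ProjSpace.toSpec, ← Category.assoc, this, Category.assoc, ← Spec.map_comp]
    rfl
  have h₂ : ((chart n R k).ι ≫ ProjSpace.toSpec n R).appTop ≫ (chart n R k).topIso.hom =
      (ProjSpace.toSpec n R).appLE ⊤ (chart n R k)
        (show chart n R k ≤ ProjSpace.toSpec n R ⁻¹ᵁ ⊤ from le_top) := by
    have h : (chart n R k).ι.appTop ≫ (chart n R k).topIso.hom =
        (ProjSpace n R).presheaf.map (homOfLE le_top).op := by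
      rw [Scheme.Opens.topIso_hom, Scheme.Opens.ι_appTop]
      exact ((ProjSpace n R).presheaf.map_comp _ _).symm
    rw [Scheme.Hom.comp_appTop, Category.assoc, h]
    rfl
  have h₃ : (Proj.basicOpenToSpec 𝒜 (MvPolynomial.X k)).appTop =
      (Scheme.ΓSpecIso _).hom ≫ Proj.awayToSection 𝒜 (MvPolynomial.X k) ≫
        (chart n R k).topIso.inv :=
    Proj.basicOpenToSpec_app_top 𝒜 (MvPolynomial.X k)
  have h₄ : (Scheme.ΓSpecIso (CommRingCat.of R)).inv ≫ (ProjSpace.toSpec n R).appLE ⊤ (chart n R k)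
      (show chart n R k ≤ ProjSpace.toSpec n R ⁻¹ᵁ ⊤ from le_top) =
      CommRingCat.ofHom (toAway n R k) ≫ Proj.awayToSection 𝒜 (MvPolynomial.X k) := by
    rw [← h₂, h₁, Scheme.Hom.comp_appTop, h₃]
    simp only [Category.assoc, Iso.inv_hom_id, Category.comp_id,
      Scheme.ΓSpecIso_naturality_assoc, Iso.inv_hom_id_assoc]
  exact congr($(h₄).hom)

/-- The coordinate ring of a standard chart is a quotient of a polynomial ring over `R`. -/
lemma exists_mvPolynomial_surjective_chart (k : Fin (n + 1)) :
    ∃ τ : MvPolynomial (Fin n) R →+* Γ(ProjSpace n R, chart n R k), Function.Surjective τ ∧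
      τ.comp MvPolynomial.C = structureHom (ProjSpace.toSpec n R) (chart n R k) := by
  refine ⟨(Proj.awayToSection (MvPolynomial.homogeneousSubmodule (Fin (n + 1)) R)
    (MvPolynomial.X k)).hom.comp (affineCoordinates n R k), ?_, ?_⟩
  · have := ConcreteCategory.bijective_of_isIso (Proj.basicOpenIsoAway
      (MvPolynomial.homogeneousSubmodule (Fin (n + 1)) R) (MvPolynomial.X k)
      (X_mem_homogeneousSubmodule n R k) one_pos).hom
    exact this.2.comp (affineCoordinates_surjective n R k)
  · rw [structureHom_chart]
    ext r
    simp [affineCoordinates]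

instance isNoetherianRing_chart [IsNoetherianRing R] (k : Fin (n + 1)) :
    IsNoetherianRing Γ(ProjSpace n R, chart n R k) :=
  have ⟨τ, hτ, _⟩ := exists_mvPolynomial_surjective_chart n R k
  isNoetherianRing_of_surjective _ _ τ hτ

/-- Restricting the chart's presentation over `R` to the fibre kills the coefficients in `ker θ`, so
it factors through polynomials over `K`. -/
lemma exists_mvPolynomial_surjective_fibre {R K : Type u} [CommRing R] [CommRing K]
    (θ : R →+* K) (hθ : Function.Surjective θ) (k : Fin (n + 1)) :
    ∃ τ : MvPolynomial (Fin n) K →+* Γ(pullback (ProjSpace.toSpec n R)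
      (Spec.map (CommRingCat.ofHom θ)),
        fibreInclusion θ (ProjSpace.toSpec n R) ⁻¹ᵁ (chart n R k)), Function.Surjective τ := by
  obtain ⟨τ, hτ, hτC⟩ := exists_mvPolynomial_surjective_chart n R k
  obtain ⟨hs, hk⟩ := fibreInclusion_app θ (ProjSpace.toSpec n R) hθ (isAffineOpen_chart n R k)
  let σ := ((fibreInclusion θ (ProjSpace.toSpec n R)).app (chart n R k)).hom.comp τ
  have hσ : Function.Surjective σ := hs.comp hτ
  have hmap := MvPolynomial.map_surjective (σ := Fin n) θ hθ
  have hle : RingHom.ker (MvPolynomial.map (σ := Fin n) θ) ≤ RingHom.ker σ := by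
    rw [MvPolynomial.ker_map, Ideal.map_le_iff_le_comap]
    intro r hr
    rw [Ideal.mem_comap, RingHom.mem_ker, RingHom.comp_apply, ← RingHom.mem_ker, hk]
    rw [show τ (MvPolynomial.C r) = structureHom (ProjSpace.toSpec n R) (chart n R k) r from
      RingHom.congr_fun hτC r]
    exact Ideal.mem_map_of_mem _ hr
  refine ⟨RingHom.liftOfSurjective _ hmap ⟨σ, hle⟩, fun c ↦ ?_⟩
  obtain ⟨p, rfl⟩ := hσ c
  exact ⟨MvPolynomial.map θ p, RingHom.liftOfRightInverse_comp_apply _ _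
    (Function.rightInverse_surjInv hmap) ⟨σ, hle⟩ p⟩

/-- Makes curves over a field Jacobson spaces, so that points closed in an affine open set are
closed. -/
lemma locallyOfFiniteType_toSpec : LocallyOfFiniteType (ProjSpace.toSpec n R) := by
  refine (HasRingHomProperty.iff_of_iSup_eq_top (P := @LocallyOfFiniteType)
    (fun k : Fin (n + 1) ↦ ⟨chart n R k, isAffineOpen_chart n R k⟩) ?_).2 fun k ↦ ?_
  · exact eq_top_iff.2 fun y _ ↦ Opens.mem_iSup.2 (exists_mem_chart n R y)
  · obtain ⟨τ, hτ, hτC⟩ := exists_mvPolynomial_surjective_chart n R k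
    have h : (structureHom (ProjSpace.toSpec n R) (chart n R k)).FiniteType := by
      rw [← hτC]
      exact RingHom.FiniteType.comp_surjective
        (RingHom.finiteType_algebraMap.2 inferInstance) hτ
    rw [structureHom, CommRingCat.hom_comp] at h
    exact RingHom.FiniteType.of_comp_finiteType h

end Plane

/-! ### Depth of the direct image at closed points. -/

section Depth

open TopologicalSpace Opposite

/-- If `O` is the local ring at `q` of a finite `C`-algebra and contains a regular non-unit, then
no nonzero element of `O` is killed by a maximal ideal of `C`. -/
lemma algebraMap_eq_zero_of_forall_mul_eq_zero {C E O : Type*} [CommRing C] [CommRing E]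
    [CommRing O] [Algebra C E] [Module.Finite C E] (p : Ideal C) [p.IsMaximal] (q : Ideal E)
    [hq : q.IsPrime] [Algebra E O] [IsLocalRing O] [IsLocalization.AtPrime O q] (r : O)
    (hr : r ∈ IsLocalRing.maximalIdeal O) (hreg : ∀ o : O, r * o = 0 → o = 0) (e : E)
    (he : ∀ c ∈ p, algebraMap E O (algebraMap C E c) * algebraMap E O e = 0) :
    algebraMap E O e = 0 := by
  let J := p.map (algebraMap C E)
  have hJ (x : E) (hx : x ∈ J) : algebraMap E O x * algebraMap E O e = 0 := by
    induction hx using Submodule.span_induction with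
    | mem x hx => obtain ⟨c, hc, rfl⟩ := hx; exact he c hc
    | zero => simp
    | add x y _ _ hx hy => rw [map_add, add_mul, hx, hy, add_zero]
    | smul a x _ hx => rw [smul_eq_mul, map_mul, mul_assoc, hx, mul_zero]
  let : Field (C ⧸ p) := Ideal.Quotient.field p
  let : Algebra (C ⧸ p) (E ⧸ J) := Ideal.Quotient.algebraQuotientOfLEComap Ideal.le_comap_map
  have : IsScalarTower C (C ⧸ p) (E ⧸ J) := .of_algebraMap_eq' rfl
  have : Module.Finite (C ⧸ p) (E ⧸ J) := .of_restrictScalars_finite C (C ⧸ p) (E ⧸ J)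
  have : IsArtinianRing (E ⧸ J) := IsArtinianRing.of_finite (C ⧸ p) (E ⧸ J)
  obtain ⟨r', s, rfl⟩ := IsLocalization.exists_mk'_eq q.primeCompl r
  have hr' : r' ∈ q := (IsLocalization.AtPrime.mk'_mem_maximal_iff O q r' s).1 hr
  have hreg' (o : O) (ho : algebraMap E O r' * o = 0) : o = 0 := by
    refine hreg o ?_
    have hs := IsLocalization.map_units O s
    rw [← hs.mul_right_eq_zero, ← mul_assoc, mul_comm (algebraMap E O s), IsLocalization.mk'_spec]
    exact ho
  -- In the Artinian ring `E/J` the powers of `r'` stabilize, so `r' ^ n * (r' * y - 1)` lies in `J`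
  -- and kills `e` in `O`. There `r'` is regular and `r' * y - 1` is a unit.
  obtain ⟨n, y, hy⟩ := IsArtinian.exists_pow_succ_smul_dvd (Ideal.Quotient.mk J r')
    (1 : E ⧸ J)
  obtain ⟨y, rfl⟩ := Ideal.Quotient.mk_surjective y
  have hmem : r' ^ n * (r' * y - 1) ∈ J := by
    rw [← Ideal.Quotient.eq_zero_iff_mem]
    simp only [smul_eq_mul, mul_one] at hy
    simp only [map_mul, map_pow, map_sub, map_one]
    rw [mul_sub, ← mul_assoc, ← pow_succ, mul_one]
    exact sub_eq_zero.2 hy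
  have hunit : IsUnit (algebraMap E O (r' * y - 1)) := by
    refine IsLocalization.map_units O (⟨r' * y - 1, fun h ↦ ?_⟩ : q.primeCompl)
    refine hq.ne_top ((Ideal.eq_top_iff_one _).2 ?_)
    have := q.sub_mem (q.mul_mem_right y hr') h
    rwa [sub_sub_cancel] at this
  have h₀ := hJ _ hmem
  have hpow (m : ℕ) (o : O) (ho : algebraMap E O r' ^ m * o = 0) : o = 0 := by
    induction m with
    | zero => simpa using ho
    | succ m ih => exact ih (hreg' _ (by rw [← mul_assoc, ← pow_succ', ho]))
  rw [map_mul, map_pow, mul_assoc] at h₀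
  exact hunit.mul_right_eq_zero.1 (hpow n _ h₀)

/-- On a Cohen-Macaulay scheme of pure dimension one, the local rings at closed points contain
regular non-units. -/
lemma exists_regular_of_isClosed {X : Scheme.{u}} (hCM : IsCohenMacaulayScheme X)
    (hdim : IsPureDimOne X) (x : X) (hx : IsClosed ({x} : Set X)) :
    ∃ r ∈ IsLocalRing.maximalIdeal (X.presheaf.stalk x),
      ∀ o : X.presheaf.stalk x, r * o = 0 → o = 0 := by
  obtain ⟨-, rs, hrs, hreg, hlen⟩ := hCM.2 x
  rcases rs with _ | ⟨r, rs⟩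
  -- An empty regular sequence means a stalk of dimension zero. But a component through `x` has
  -- dimension one, so its generic point differs from `x` and gives a second prime of the stalk.
  · exfalso
    have hZ := irreducibleComponent_mem_irreducibleComponents x
    have hZc := isClosed_of_mem_irreducibleComponents _ hZ
    obtain ⟨z, hz⟩ := QuasiSober.sober hZ.1 hZc
    have hzx : z ≠ x := by
      rintro rfl
      have h1 := hdim _ hZ
      have hs : irreducibleComponent z = {z} := by rw [← hz.def, hx.closure_eq]
      rw [hs] at h1
      have h2 := topologicalKrullDim_zero_of_discreteTopology ({z} : Set X)
      rw [h1] at h2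
      exact absurd h2 (by decide)
    have hspec : z ⤳ x := by
      rw [specializes_iff_mem_closure, hz.def]
      exact mem_irreducibleComponent
    obtain ⟨P, hP⟩ : z ∈ Set.range (X.fromSpecStalk x) := by
      rw [Scheme.range_fromSpecStalk]; exact hspec
    have hdim0 : ringKrullDim (X.presheaf.stalk x) ≤ (0 : ℕ) := by
      rw [← hlen]; simp
    have : Ring.KrullDimLE 0 (X.presheaf.stalk x) := (Ring.krullDimLE_iff).2 hdim0
    have hPm : P = IsLocalRing.closedPoint (X.presheaf.stalk x) :=
      PrimeSpectrum.ext (IsLocalRing.eq_maximalIdeal (P.2.isMaximal'))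
    rw [hPm, Scheme.fromSpecStalk_closedPoint] at hP
    exact hzx hP.symm
  · refine ⟨r, hrs r (by simp), fun o ho ↦ ?_⟩
    exact ((RingTheory.Sequence.isRegular_cons_iff _ _ _).1 hreg).1.right_eq_zero_of_smul ho

/-- For a finite morphism from a Cohen-Macaulay curve, no nonzero element of the stalk of the
direct image at a closed point is killed by the maximal ideal. -/
theorem eq_zero_of_forall_maximalIdeal_smul {X Y : Scheme.{u}} (i : X ⟶ Y) [IsFinite i]
    [JacobsonSpace X] (hCM : IsCohenMacaulayScheme X) (hdim : IsPureDimOne X)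
    {U : Y.Opens} (hU : IsAffineOpen U) (y : Y) (hy : y ∈ U)
    (hmax : (hU.primeIdealOf ⟨y, hy⟩).asIdeal.IsMaximal) (b : PushforwardStalk i y)
    (hb : ∀ a ∈ IsLocalRing.maximalIdeal (Y.presheaf.stalk y), a • b = 0) : b = 0 := by
  let p := (hU.primeIdealOf ⟨y, hy⟩).asIdeal
  have hW : IsAffineOpen (i ⁻¹ᵁ U) := hU.preimage i
  let γ := pushforwardGerm i U y hy
  let : Algebra Γ(Y, U) (Y.presheaf.stalk y) := Y.presheaf.algebra_section_stalk ⟨y, hy⟩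
  let : Algebra Γ(X, i ⁻¹ᵁ U) (PushforwardStalk i y) := γ.toAlgebra
  let : Algebra Γ(Y, U) Γ(X, i ⁻¹ᵁ U) := (i.app U).hom.toAlgebra
  have : Module.Finite Γ(Y, U) Γ(X, i ⁻¹ᵁ U) := i.finite_app U hU
  have : IsLocalization.AtPrime (Y.presheaf.stalk y) p := hU.isLocalization_stalk ⟨y, hy⟩
  have : IsLocalization (p.primeCompl.map (i.app U).hom) (PushforwardStalk i y) :=
    isLocalization_pushforwardGerm i hU y hy
  by_contra hb0
  obtain ⟨⟨e, m⟩, hem⟩ := IsLocalization.surj (p.primeCompl.map (i.app U).hom) b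
  replace hem : b * γ m = γ e := hem
  have hmu : IsUnit (γ m) := IsLocalization.map_units (PushforwardStalk i y) m
  have he0 : γ e ≠ 0 := by
    rw [← hem]
    exact fun h ↦ hb0 (hmu.mul_left_eq_zero.1 h)
  have hpe (c : Γ(Y, U)) (hc : c ∈ p) : γ (i.app U c * e) = 0 := by
    have h₁ : algebraMap (Y.presheaf.stalk y) (PushforwardStalk i y)
        (Y.presheaf.germ U y hy c) = γ (i.app U c) := algebraMap_germ i U y hy c
    have h₂ : Y.presheaf.germ U y hy c ∈ IsLocalRing.maximalIdeal (Y.presheaf.stalk y) :=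
      (IsLocalization.AtPrime.to_map_mem_maximal_iff (Y.presheaf.stalk y) p c).2 hc
    have h₃ := hb _ h₂
    rw [Algebra.smul_def, h₁] at h₃
    rw [map_mul, ← hem, ← mul_assoc, h₃, zero_mul]
  -- The annihilator of `γ e`. A maximal ideal `q` above it lies over `p`, hence gives a closed
  -- point `x` of `X`; vanishing of `e` in the stalk at `x` then produces an element of `J` outside
  -- `q`.
  let J : Ideal Γ(X, i ⁻¹ᵁ U) := (RingHom.ker γ).colon {e}
  have hJmem (x) : x ∈ J ↔ γ (x * e) = 0 := by
    rw [Submodule.mem_colon_singleton]; exact RingHom.mem_ker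
  have hJ : J ≠ ⊤ := by
    rw [Ne, Ideal.eq_top_iff_one, hJmem, one_mul]
    exact he0
  obtain ⟨q, hq, hJq⟩ := J.exists_le_maximal hJ
  have hqp : q.comap (i.app U).hom = p := by
    refine (hmax.eq_of_le (Ideal.comap_ne_top _ hq.ne_top) fun c hc ↦ ?_).symm
    exact hJq ((hJmem _).2 (hpe c hc))
  let Q : PrimeSpectrum Γ(X, i ⁻¹ᵁ U) := ⟨q, hq.isPrime⟩
  let x : X := hW.fromSpec Q
  have hxW : x ∈ i ⁻¹ᵁ U := by
    have : x ∈ Set.range hW.fromSpec := ⟨Q, rfl⟩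
    rwa [hW.range_fromSpec] at this
  have hxc : IsClosed ({x} : Set X) := by
    refine isClosed_singleton_of_isLocallyClosed_singleton ?_
    have hQ : IsClosed ({Q} : Set (Spec Γ(X, i ⁻¹ᵁ U))) :=
      (PrimeSpectrum.isClosed_singleton_iff_isMaximal Q).2 hq
    have := hQ.isLocallyClosed.image hW.fromSpec.isOpenEmbedding.isInducing
      hW.fromSpec.isOpenEmbedding.isOpen_range.isLocallyClosed
    exact (Set.image_singleton (f := hW.fromSpec) (a := Q)) ▸ this
  obtain ⟨r, hr, hreg⟩ := exists_regular_of_isClosed hCM hdim x hxc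
  let : Algebra Γ(X, i ⁻¹ᵁ U) (X.presheaf.stalk x) := X.presheaf.algebra_section_stalk ⟨x, hxW⟩
  have : IsLocalization.AtPrime (X.presheaf.stalk x) q := hW.isLocalization_stalk' Q hxW
  have hex := algebraMap_eq_zero_of_forall_mul_eq_zero p q r hr hreg e fun c hc ↦ by
    have h₁ : algebraMap Γ(X, i ⁻¹ᵁ U) (PushforwardStalk i y) (i.app U c * e) = 0 := hpe c hc
    obtain ⟨⟨_, d, hd, rfl⟩, h₂⟩ :=
      (IsLocalization.map_eq_zero_iff (p.primeCompl.map (i.app U).hom) _ _).1 h₁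
    have hdq : i.app U d ∈ q.primeCompl := fun h ↦ hd (by
      rw [← hqp]; exact h)
    have hdu := IsLocalization.map_units (X.presheaf.stalk x) (⟨_, hdq⟩ : q.primeCompl)
    have h₃ := congr_arg (algebraMap Γ(X, i ⁻¹ᵁ U) (X.presheaf.stalk x)) h₂
    rw [map_mul, map_mul, map_zero] at h₃
    exact hdu.mul_right_eq_zero.1 h₃
  obtain ⟨⟨s, hs⟩, hse⟩ := (IsLocalization.map_eq_zero_iff q.primeCompl _ _).1 hex
  refine hs (hJq ((hJmem s).2 ?_))
  rw [show s * e = 0 from hse, map_zero]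

end Depth

/-! ### Plain double points, conductors and relations on the closed fibre. -/

section Conductor

/-- At a plain double point, `(i_* 𝒪_X)_P` is generated by `1` and one further element. -/
lemma exists_pairMap_surjective_of_length_eq_one {X Y : Scheme.{u}} (i : X ⟶ Y) (η : i.image)
    (h : Module.length (i.image.presheaf.stalk η) (CokernelStalk i η) = 1) :
    ∃ v : PushforwardStalk i (i.imageι η),
      Function.Surjective (pairMap (Y.presheaf.stalk (i.imageι η)) v) ∧
        ∀ a : Y.presheaf.stalk (i.imageι η), algebraMap _ (PushforwardStalk i (i.imageι η)) a ≠ v := by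
  obtain ⟨e, he⟩ := exists_pushforwardStalk_ringEquiv i.toImage i.imageι i i.toImage_imageι η
  have hsurj : Function.Surjective (i.imageι.stalkMap η) := i.imageι.stalkMap_surjective η
  have hsimple : IsSimpleModule (i.image.presheaf.stalk η) (CokernelStalk i η) :=
    Module.length_eq_one_iff.1 h
  have := IsSimpleModule.nontrivial (i.image.presheaf.stalk η) (CokernelStalk i η)
  obtain ⟨w, hw⟩ := exists_ne (0 : CokernelStalk i η)
  obtain ⟨v, rfl⟩ := Submodule.Quotient.mk_surjective _ w
  refine ⟨e.symm v, fun b ↦ ?_, fun a ha ↦ ?_⟩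
  · have hspan := IsSimpleModule.span_singleton_eq_top (i.image.presheaf.stalk η) hw
    have hb : Submodule.Quotient.mk (e b) ∈
        Submodule.span (i.image.presheaf.stalk η) {(Submodule.Quotient.mk v : CokernelStalk i η)} :=
      hspan ▸ trivial
    obtain ⟨d, hd⟩ := Submodule.mem_span_singleton.1 hb
    rw [← Submodule.Quotient.mk_smul, eq_comm, Submodule.Quotient.eq] at hd
    obtain ⟨c, hc⟩ := hd
    obtain ⟨d, rfl⟩ := hsurj d
    obtain ⟨c, rfl⟩ := hsurj c
    refine ⟨![c, d], e.injective ?_⟩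
    rw [pairMap_apply]
    simp only [Matrix.cons_val_zero, Matrix.cons_val_one, map_add, map_mul, he,
      RingEquiv.apply_symm_apply]
    rw [Algebra.linearMap_apply, Algebra.smul_def] at hc
    exact (eq_sub_iff_add_eq.1 hc)
  · refine hw ((Submodule.Quotient.mk_eq_zero _).2 ⟨i.imageι.stalkMap η a, ?_⟩)
    rw [Algebra.linearMap_apply, ← he, ha, RingEquiv.apply_symm_apply]

/-- The annihilator of `(i_* 𝒪_X / 𝒪_D)_η` is the image of the conductor of
`𝒪_{Y,η} → (i_* 𝒪_X)_η`. -/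
lemma map_eq_annihilator_cokernelStalk {X Y : Scheme.{u}} (i : X ⟶ Y) (η : i.image)
    (I : Ideal (Y.presheaf.stalk (i.imageι η)))
    (hI : ∀ a, a ∈ I ↔ ∀ b : PushforwardStalk i (i.imageι η), ∃ c,
      algebraMap _ (PushforwardStalk i (i.imageι η)) a * b =
        algebraMap (Y.presheaf.stalk (i.imageι η)) _ c) :
    RingHom.ker (i.imageι.stalkMap η).hom ≤ I ∧
      I.map (i.imageι.stalkMap η).hom =
        Module.annihilator (i.image.presheaf.stalk η) (CokernelStalk i η) := by
  obtain ⟨e, he⟩ := exists_pushforwardStalk_ringEquiv i.toImage i.imageι i i.toImage_imageι η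
  have hsurj : Function.Surjective (i.imageι.stalkMap η) := i.imageι.stalkMap_surjective η
  have key (a : Y.presheaf.stalk (i.imageι η)) : a ∈ I ↔ i.imageι.stalkMap η a ∈
      Module.annihilator (i.image.presheaf.stalk η) (CokernelStalk i η) := by
    rw [hI, Module.mem_annihilator]
    constructor
    · intro h w
      obtain ⟨b, rfl⟩ := Submodule.Quotient.mk_surjective _ w
      obtain ⟨c, hc⟩ := h (e.symm b)
      rw [← Submodule.Quotient.mk_smul, Submodule.Quotient.mk_eq_zero]
      refine ⟨i.imageι.stalkMap η c, ?_⟩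
      have := congr_arg e hc
      rw [map_mul, he, he, RingEquiv.apply_symm_apply] at this
      rw [Algebra.linearMap_apply, Algebra.smul_def, this]
    · intro h b
      have := h (Submodule.Quotient.mk (e b))
      rw [← Submodule.Quotient.mk_smul, Submodule.Quotient.mk_eq_zero] at this
      obtain ⟨c, hc⟩ := this
      obtain ⟨c, rfl⟩ := hsurj c
      refine ⟨c, e.injective ?_⟩
      rw [map_mul, he, he, ← Algebra.smul_def, ← hc, Algebra.linearMap_apply]
  refine ⟨fun a ha ↦ (key a).2 ?_, ?_⟩
  · rw [show i.imageι.stalkMap η a = 0 from ha]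
    exact zero_mem _
  · refine le_antisymm (Ideal.map_le_iff_le_comap.2 fun a ha ↦ (key a).1 ha) fun d hd ↦ ?_
    obtain ⟨a, rfl⟩ := hsurj d
    exact Ideal.mem_map_of_mem (i.imageι.stalkMap η).hom ((key a).2 hd)

/-- The points of the schematic image of a finite morphism are images of points. -/
lemma exists_apply_eq_imageι {X Y : Scheme.{u}} (i : X ⟶ Y) [IsFinite i] (η : i.image) :
    ∃ x, i x = i.imageι η := by
  have h : i.imageι η ∈ Set.range i.imageι := ⟨η, rfl⟩
  rw [Scheme.IdealSheafData.range_subschemeι, Scheme.Hom.support_ker,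
    i.isClosedMap.isClosed_range.closure_eq] at h
  exact h

/-- The relations between two generators of the direct image of a plane Cohen-Macaulay curve are
generated by two elements. -/
lemma exists_ker_pairMap_eq_span_pair {R K : Type u} [CommRing R] [Field K] [IsAlgClosed K]
    (θ : R →+* K) (hθ : Function.Surjective θ) {X : Scheme.{u}}
    (i : X ⟶ fibreSpace 2 (Spec.map (CommRingCat.ofHom θ)))
    (hi : IsCMCurve i) (P : ↥(fibreSpace 2 (Spec.map (CommRingCat.ofHom θ))))
    (v : PushforwardStalk i P)
    (hv : Function.Surjective
      (pairMap ((fibreSpace 2 (Spec.map (CommRingCat.ofHom θ))).presheaf.stalk P) v)) :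
    ∃ n₁ n₂, LinearMap.ker
      (pairMap ((fibreSpace 2 (Spec.map (CommRingCat.ofHom θ))).presheaf.stalk P) v) =
        Submodule.span _ {n₁, n₂} := by
  have := hi.finite
  have : IsClosedImmersion (Spec.map (CommRingCat.ofHom θ)) :=
    IsClosedImmersion.spec_of_surjective _ hθ
  have := locallyOfFiniteType_toSpec 2 R
  have : JacobsonSpace X := LocallyOfFiniteType.jacobsonSpace
    (i ≫ pullback.snd (ProjSpace.toSpec 2 R) (Spec.map (CommRingCat.ofHom θ)))
  obtain ⟨k, hk⟩ := exists_mem_chart 2 R (fibreInclusion θ (ProjSpace.toSpec 2 R) P)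
  let V : (fibreSpace 2 (Spec.map (CommRingCat.ofHom θ))).Opens :=
    fibreInclusion θ (ProjSpace.toSpec 2 R) ⁻¹ᵁ (chart 2 R k)
  have hV : IsAffineOpen V := (isAffineOpen_chart 2 R k).preimage _
  have hPV : P ∈ V := hk
  obtain ⟨τ, hτ⟩ : ∃ τ : MvPolynomial (Fin 2) K →+*
      Γ(fibreSpace 2 (Spec.map (CommRingCat.ofHom θ)), V), Function.Surjective τ :=
    exists_mvPolynomial_surjective_fibre 2 θ hθ k
  let A := (fibreSpace 2 (Spec.map (CommRingCat.ofHom θ))).presheaf.stalk P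
  let : Algebra Γ(fibreSpace 2 (Spec.map (CommRingCat.ofHom θ)), V) A :=
    (fibreSpace 2 (Spec.map (CommRingCat.ofHom θ))).presheaf.algebra_section_stalk ⟨P, hPV⟩
  let p := (hV.primeIdealOf ⟨P, hPV⟩).asIdeal
  have : IsLocalization.AtPrime A p := hV.isLocalization_stalk ⟨P, hPV⟩
  have : IsNoetherianRing Γ(fibreSpace 2 (Spec.map (CommRingCat.ofHom θ)), V) :=
    isNoetherianRing_of_surjective _ _ τ hτ
  have : IsNoetherianRing A := IsLocalization.isNoetherianRing p.primeCompl A inferInstance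
  have : Module.Finite A (PushforwardStalk i P) := Module.Finite.of_surjective _ hv
  -- The depth argument is needed only at closed points; where the maximal ideal is principal, any
  -- submodule of `A²` has two generators.
  rcases maximalIdeal_of_surjective_mvPolynomial (A := A) τ hτ p with ⟨hp, x, y, hxy⟩ | ⟨w, hw⟩
  · exact exists_ker_eq_span_pair x y hxy
      (eq_zero_of_forall_maximalIdeal_smul i hi.cohenMacaulay hi.pureDimOne hV P hPV hp) _
  · have := isPrincipalIdealRing_of_maximalIdeal w hw
    exact exists_span_pair_of_isPrincipalIdealRing _

end Conductor

end CMCurve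

end

theorem mainTheorem10 {R : Type u} [CommRing R] [IsLocalRing R] [IsNoetherianRing R]
    [IsAlgClosed (IsLocalRing.ResidueField R)] {X : Scheme.{u}}
    (i : X ⟶ CMCurve.ProjSpace 2 R) (hi : CMCurve.IsCMFamily i)
    (P : ↥(CMCurve.fibreSpace 2 (CMCurve.closedPt R)))
    (hP : CMCurve.IsPlainDoublePoint (CMCurve.fibreMap i (CMCurve.closedPt R)) P) :
    ∃ η : ↥i.image, i.imageι η = CMCurve.fibreSpaceMap 2 (CMCurve.closedPt R) P ∧
      ∃ g f s t : (CMCurve.ProjSpace 2 R).presheaf.stalk (i.imageι η),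
        (∃ π : (Fin 2 → (CMCurve.ProjSpace 2 R).presheaf.stalk (i.imageι η)) →ₗ[
              (CMCurve.ProjSpace 2 R).presheaf.stalk (i.imageι η)]
              CMCurve.PushforwardStalk i (i.imageι η),
          Function.Surjective π ∧ LinearMap.ker π = LinearMap.range (!![g, f; s, t]).mulVecLin) ∧
        s ∈ IsLocalRing.maximalIdeal
          ((CMCurve.ProjSpace 2 R).presheaf.stalk (i.imageι η)) ∧
        t ∈ IsLocalRing.maximalIdeal
          ((CMCurve.ProjSpace 2 R).presheaf.stalk (i.imageι η)) ∧
        g ∈ Ideal.span {s, t} ∧ f ∈ Ideal.span {s, t} ∧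
        RingHom.ker (i.imageι.stalkMap η).hom ≤ Ideal.span {s, t} ∧
        (Ideal.span {s, t}).map (i.imageι.stalkMap η).hom =
          Module.annihilator (i.image.presheaf.stalk η) (CMCurve.CokernelStalk i η) := by
  have := hi.finite
  have := hi.flat
  have hcm := hi.geometricFibre (IsLocalRing.ResidueField R) (CMCurve.closedPt R)
  have := hcm.finite
  obtain ⟨η₀, rfl, hlen⟩ := hP
  obtain ⟨v, hv, hv'⟩ := CMCurve.exists_pairMap_surjective_of_length_eq_one _ η₀ hlen
  have hN := CMCurve.exists_ker_pairMap_eq_span_pair (IsLocalRing.residue R)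
    IsLocalRing.residue_surjective _ hcm _ v hv
  obtain ⟨x₀, hx₀⟩ := CMCurve.exists_apply_eq_imageι _ η₀
  generalize Scheme.Hom.imageι _ η₀ = P at *
  obtain ⟨k, hk⟩ := CMCurve.exists_mem_chart 2 R
    (CMCurve.fibreSpaceMap 2 (CMCurve.closedPt R) P)
  have hpres := CMCurve.exists_presentation_of_fibre (IsLocalRing.residue R)
    (CMCurve.ProjSpace.toSpec 2 R) IsLocalRing.residue_surjective i
    (CMCurve.isAffineOpen_chart 2 R k) P hk v hv hv' hN
  obtain ⟨η, hη⟩ : ∃ η : ↥i.image,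
      i.imageι η = CMCurve.fibreSpaceMap 2 (CMCurve.closedPt R) P := by
    -- A point `x₀` of the closed fibre above `P`, viewed in `X`, shows that `ξ` lies on the image
    -- of the family.
    refine ⟨i.toImage (pullback.fst i (CMCurve.fibreSpaceMap 2 (CMCurve.closedPt R)) x₀), ?_⟩
    rw [← Scheme.Hom.comp_apply, Scheme.Hom.toImage_imageι, ← Scheme.Hom.comp_apply,
      pullback.condition, Scheme.Hom.comp_apply, hx₀]
  refine ⟨η, hη, ?_⟩
  rw [← hη] at hpres
  obtain ⟨g, f, s, t, hπ, hs, ht, hg, hf, hcond⟩ := hpres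
  obtain ⟨h₁, h₂⟩ := CMCurve.map_eq_annihilator_cokernelStalk i η _ hcond
  exact ⟨g, f, s, t, hπ, hs, ht, hg, hf, h₁, h₂⟩
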